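/- Let $N\in\mathbb{N}$ and let $A,B\in M_N(\mathbb{Z})$ satisfy: $A_{i,j}\ge 0$ for all $i,j$; $A$ has no identically zero row; and $B_{i,j}=0$ whenever $A_{i,j}=0$. Let $E$ be the directed graph with vertex set $\{1,\dots,N\}$ and edges $e_{i,j,n}$, $0\le n<A_{i,j}$, with source $s(e_{i,j,n})=i$ and range $r(e_{i,j,n})=j$. For $m\in\mathbb{Z}$ and an edge $e_{i,j,n}$ write $mB_{i,j}+n=kA_{i,j}+l$ with $k,l\in\mathbb{Z}$ and $0\le l<A_{i,j}$, and set $\kappa_m(e_{i,j,n})=e_{i,j,l}$ and $\varphi(m,e_{i,j,n})=k$. The pair $(A,B)$ is called pseudo free if $\kappa_m(e)=e$ and $\varphi(m,e)=0$, for $m\in\mathbb{Z}$ and an edge $e$, imply $m=0$. Let $E^*$ be the set of finite paths (including the vertices as paths of length zero) and $E^\infty$ the space of infinite paths $x=x_1x_2\cdots$, $r(x_i)=s(x_{i+1})$, with the topology induced by the product of the discrete topologies. For $\beta\in E^*$ let $Z(\beta)=\{\beta y: y\in E^\infty,\ s(y)=r(\beta)\}$. The action extends to $E^\infty$ by $\kappa_m(\gamma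 y)=\kappa_m(\gamma)\kappa_{\varphi(m,\gamma)}(y)$ for edges $\gamma$. The Katsura--Exel--Pardo groupoid $\mathcal{G}_{A,B}$ is the set of classes $[\alpha,m,\beta;x]$ of quadruples with $\alpha,\beta\in E^*$, $r(\alpha)=r(\beta)$, $m\in\mathbb{Z}$, $x\in Z(\beta)$, under the equivalence relation generated by $(\alpha,m,\beta;x)\sim(\alpha\kappa_m(\gamma),\varphi(m,\gamma),\beta\gamma;x)$ for $x=\beta\gamma y$ with $\gamma$ an edge. Its units are the elements $[v,0,v;x]$ with $v=s(x)$, identified with $x\in E^\infty$; source and range are $s([\alpha,m,\beta;\beta y])=\beta y$ and $r([\alpha,m,\beta;\beta y])=\alpha\kappa_m(y)$; the product is $[\alpha,m',\beta;\beta\kappa_m(y)]\cdot[\beta,m,\gamma;\gamma y]=[\alpha,m'+m,\gamma;\gamma y]$ and the inverse is $[\alpha,m,\beta;\beta y]^{-1}=[\beta,-m,\alpha;\alpha\kappa_m(y)]$. Its topology is generated by the sets $\{[\alpha,m,\beta;x]:x\in U\}$ with $U\subseteq Z(\beta)$ compact and open. Two étale groupoids $\mathcal{G},\mathcal{H}$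 with totally disconnected unit spaces are called Kakutani equivalent if there are clopen sets $S\subseteq\mathcal{G}^{(0)}$ and $T\subseteq\mathcal{H}^{(0)}$, each meeting every orbit, such that the restrictions $\{g\in\mathcal{G}: s(g),r(g)\in S\}$ and $\{h\in\mathcal{H}: s(h),r(h)\in T\}$ are isomorphic as topological groupoids. Let $N,N'\in\mathbb{N}$, and let $A,B\in M_N(\mathbb{Z})$ and $A',B'\in M_{N'}(\mathbb{Z})$ be pseudo free pairs, each satisfying the three conditions at the beginning. If $\mathcal{G}_{A,B}$ and $\mathcal{G}_{A',B'}$ are Kakutani equivalent, then $\ker(I-A)\cong\ker(I-A')$ and $\ker(I-B)\cong\ker(I-B')$ as abelian groups, where the kernels are those of the endomorphisms of $\mathbb{Z}^N$ and $\mathbb{Z}^{N'}$ given by the matrices. -/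

import Mathlib

/-- A groupoid, presented by its set of arrows `G`: units are particular arrows, the product
`g * h` is defined exactly when the source of `g` is the range of `h`. -/
class ArrowGroupoid (G : Type*) where
  src : G → G
  rng : G → G
  inv : G → G
  mul : ∀ g h : G, src g = rng h → G
  src_src : ∀ g, src (src g) = src g
  rng_src : ∀ g, rng (src g) = src g
  src_rng : ∀ g, src (rng g) = rng g
  rng_rng : ∀ g, rng (rng g) = rng g
  src_mul : ∀ g h (c : src g = rng h), src (mul g h c) = src h
  rng_mul : ∀ g h (c : src g = rng h), rng (mul g h c) = rng g
  mul_assoc : ∀ g h k (c : src g = rng h) (d : src h = rng k),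
    mul (mul g h c) k ((src_mul g h c).trans d) = mul g (mul h k d) (c.trans (rng_mul h k d).symm)
  mul_src : ∀ g, mul g (src g) (rng_src g).symm = g
  rng_mul_self : ∀ g, mul (rng g) g (src_rng g) = g
  src_inv : ∀ g, src (inv g) = rng g
  rng_inv : ∀ g, rng (inv g) = src g
  mul_inv : ∀ g, mul g (inv g) (rng_inv g).symm = rng g
  inv_mul : ∀ g, mul (inv g) g (src_inv g) = src g

namespace ArrowGroupoid

/-- The unit space: the arrows that are their own source. As a subtype it carries the relative
topology whenever `G` has a topology. -/
def UnitSpace (G : Type*) [ArrowGroupoid G] : Type _ := {u : G // src u = u}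

instance (G : Type*) [ArrowGroupoid G] [TopologicalSpace G] : TopologicalSpace (UnitSpace G) :=
  inferInstanceAs (TopologicalSpace {u : G // src u = u})

variable {G : Type*} [ArrowGroupoid G]

/-- The source map with values in the unit space. -/
def source (g : G) : UnitSpace G := ⟨src g, src_src g⟩

/-- The range map with values in the unit space. -/
def range (g : G) : UnitSpace G := ⟨rng g, src_rng g⟩

/-- A set of units is full if it meets every orbit. -/
def IsFull (S : Set (UnitSpace G)) : Prop :=
  ∀ x : UnitSpace G, ∃ g : G, source g = x ∧ range g ∈ S

/-- The restriction of `G` to a set `S` of units: all arrows with source and range in `S`.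
As a subtype it carries the relative topology whenever `G` has a topology. -/
def Restriction (S : Set (UnitSpace G)) : Type _ := {g : G // source g ∈ S ∧ range g ∈ S}

instance (S : Set (UnitSpace G)) [TopologicalSpace G] : TopologicalSpace (Restriction S) :=
  inferInstanceAs (TopologicalSpace {g : G // source g ∈ S ∧ range g ∈ S})

theorem source_eq_of {g h : G} (c : src g = src h) : source g = source h := Subtype.ext c

theorem range_eq_of {g h : G} (c : rng g = rng h) : range g = range h := Subtype.ext c

theorem source_eq_range_of {g h : G} (c : src g = rng h) : source g = range h := Subtype.ext c

instance (S : Set (UnitSpace G)) : ArrowGroupoid (Restriction S) where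
  src g := ⟨src g.1, by rw [source_eq_of (src_src g.1)]; exact g.2.1,
    by rw [← source_eq_range_of (rng_src g.1).symm]; exact g.2.1⟩
  rng g := ⟨rng g.1, by rw [source_eq_range_of (h := g.1) (src_rng g.1)]; exact g.2.2,
    by rw [range_eq_of (rng_rng g.1)]; exact g.2.2⟩
  inv g := ⟨inv g.1, by rw [source_eq_range_of (src_inv g.1)]; exact g.2.2,
    by rw [← source_eq_range_of (rng_inv g.1).symm]; exact g.2.1⟩
  mul g h c := ⟨mul g.1 h.1 (congrArg Subtype.val c),
    by rw [source_eq_of (src_mul g.1 h.1 _)]; exact h.2.1,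
    by rw [range_eq_of (rng_mul g.1 h.1 _)]; exact g.2.2⟩
  src_src g := Subtype.ext (src_src g.1)
  rng_src g := Subtype.ext (rng_src g.1)
  src_rng g := Subtype.ext (src_rng g.1)
  rng_rng g := Subtype.ext (rng_rng g.1)
  src_mul g h c := Subtype.ext (src_mul g.1 h.1 _)
  rng_mul g h c := Subtype.ext (rng_mul g.1 h.1 _)
  mul_assoc g h k c d := Subtype.ext (mul_assoc g.1 h.1 k.1 _ _)
  mul_src g := Subtype.ext (mul_src g.1)
  rng_mul_self g := Subtype.ext (rng_mul_self g.1)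
  src_inv g := Subtype.ext (src_inv g.1)
  rng_inv g := Subtype.ext (rng_inv g.1)
  mul_inv g := Subtype.ext (mul_inv g.1)
  inv_mul g := Subtype.ext (inv_mul g.1)

/-- An isomorphism of topological groupoids: a homeomorphism such that two arrows are composable
if and only if their images are, and which carries products to products. -/
structure TopIso (G H : Type*) [ArrowGroupoid G] [ArrowGroupoid H]
    [TopologicalSpace G] [TopologicalSpace H] extends G ≃ₜ H where
  composable_iff : ∀ g h : G, src g = rng h ↔ src (toFun g) = rng (toFun h)
  map_mul : ∀ (g h : G) (c : src g = rng h),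
    toFun (mul g h c) = mul (toFun g) (toFun h) ((composable_iff g h).1 c)

/-- Kakutani equivalence: there are full clopen subsets of the unit spaces such that the
restrictions to them are isomorphic as topological groupoids. -/
def KakutaniEquivalent (G H : Type*) [ArrowGroupoid G] [ArrowGroupoid H]
    [TopologicalSpace G] [TopologicalSpace H] : Prop :=
  ∃ (S : Set (UnitSpace G)) (T : Set (UnitSpace H)), IsClopen S ∧ IsFull S ∧ IsClopen T ∧ IsFull T ∧
    Nonempty (TopIso (Restriction S) (Restriction T))

end ArrowGroupoid

namespace Katsura

/-- The edges `e_{i,j,n}`, `0 ≤ n < A i j`, of the graph with vertex set `Fin N`; the edge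
`e_{i,j,n}` goes from `i` (its source) to `j` (its range). -/
@[ext]
structure Edge {N : ℕ} (A : Matrix (Fin N) (Fin N) ℤ) where
  src : Fin N
  tgt : Fin N
  idx : ℤ
  idx_nonneg : 0 ≤ idx
  idx_lt : idx < A src tgt

variable {N : ℕ} {A : Matrix (Fin N) (Fin N) ℤ} (B : Matrix (Fin N) (Fin N) ℤ)

theorem Edge.pos (e : Edge A) : 0 < A e.src e.tgt := e.idx_nonneg.trans_lt e.idx_lt

/-- The set of edges is discrete. -/
instance : TopologicalSpace (Edge A) := ⊥

/-- `κ_m(e_{i,j,n}) = e_{i,j,l}`, where `m B_{i,j} + n = k A_{i,j} + l` with `0 ≤ l < A_{i,j}`. -/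
def act (m : ℤ) (e : Edge A) : Edge A where
  src := e.src
  tgt := e.tgt
  idx := (m * B e.src e.tgt + e.idx) % A e.src e.tgt
  idx_nonneg := Int.emod_nonneg _ e.pos.ne'
  idx_lt := Int.emod_lt_of_pos _ e.pos

/-- `φ(m, e_{i,j,n}) = k`, where `m B_{i,j} + n = k A_{i,j} + l` with `0 ≤ l < A_{i,j}`. -/
def coc (m : ℤ) (e : Edge A) : ℤ := (m * B e.src e.tgt + e.idx) / A e.src e.tgt

/-- The pair `(A, B)` is pseudo free: `κ_m(e) = e` and `φ(m, e) = 0` force `m = 0`. -/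
def PseudoFree (A B : Matrix (Fin N) (Fin N) ℤ) : Prop :=
  ∀ (m : ℤ) (e : Edge A), act B m e = e → coc B m e = 0 → m = 0

@[simp] theorem act_src (m : ℤ) (e : Edge A) : (act B m e).src = e.src := rfl

@[simp] theorem act_tgt (m : ℤ) (e : Edge A) : (act B m e).tgt = e.tgt := rfl

theorem coc_mul_add (m : ℤ) (e : Edge A) :
    coc B m e * A e.src e.tgt + (act B m e).idx = m * B e.src e.tgt + e.idx :=
  Int.ediv_mul_add_emod _ _

theorem act_coc_eq {m k : ℤ} {e f : Edge A} (hs : f.src = e.src) (ht : f.tgt = e.tgt)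
    (h : m * B e.src e.tgt + e.idx = k * A e.src e.tgt + f.idx) :
    act B m e = f ∧ coc B m e = k := by
  have h0 := f.idx_nonneg
  have h1 := f.idx_lt
  rw [hs, ht] at h1
  have h2 : (m * B e.src e.tgt + e.idx) / A e.src e.tgt = k ∧
      (m * B e.src e.tgt + e.idx) % A e.src e.tgt = f.idx := by
    rw [Int.ediv_emod_unique e.pos]
    refine ⟨?_, h0, h1⟩
    rw [h]; ring
  exact ⟨Edge.ext hs.symm ht.symm h2.2, h2.1⟩

theorem act_coc_add (m n : ℤ) (e : Edge A) :
    act B (m + n) e = act B m (act B n e) ∧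
      coc B (m + n) e = coc B m (act B n e) + coc B n e := by
  refine act_coc_eq B (f := act B m (act B n e)) rfl rfl ?_
  have h1 := coc_mul_add B n e
  have h2 := coc_mul_add B m (act B n e)
  simp only [act_src, act_tgt] at h2
  linarith

theorem act_coc_zero (e : Edge A) : act B 0 e = e ∧ coc B 0 e = 0 := by
  apply act_coc_eq B rfl rfl
  ring

/-- The infinite path space, with the topology induced by the product topology. -/
def InfPath (A : Matrix (Fin N) (Fin N) ℤ) : Type :=
  {x : ℕ → Edge A // ∀ n, (x n).tgt = (x (n + 1)).src}

instance : TopologicalSpace (InfPath A) :=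
  inferInstanceAs (TopologicalSpace {x : ℕ → Edge A // ∀ n, (x n).tgt = (x (n + 1)).src})

namespace InfPath

/-- The source vertex of an infinite path. -/
def start (x : InfPath A) : Fin N := (x.1 0).src

/-- The infinite path without its first edge. -/
def shift (x : InfPath A) : InfPath A := ⟨fun n => x.1 (n + 1), fun n => x.2 (n + 1)⟩

/-- The integer acting on the `n`-th edge when `m` acts on the infinite path `x`, that is,
`φ(m, x_{|n})`. -/
def cocSeq (m : ℤ) (x : InfPath A) : ℕ → ℤ
  | 0 => m
  | n + 1 => coc B (cocSeq m x n) (x.1 n)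

/-- The action `κ_m` on infinite paths, determined by
`κ_m(γ y) = κ_m(γ) κ_{φ(m, γ)}(y)` for edges `γ`. -/
def act (m : ℤ) (x : InfPath A) : InfPath A :=
  ⟨fun n => Katsura.act B (cocSeq B m x n) (x.1 n), fun n => x.2 n⟩

theorem start_shift (x : InfPath A) : (shift x).start = (x.1 0).tgt := (x.2 0).symm

@[simp] theorem start_act (m : ℤ) (x : InfPath A) : (act B m x).start = x.start := rfl

theorem cocSeq_shift (m : ℤ) (x : InfPath A) (n : ℕ) :
    cocSeq B (coc B m (x.1 0)) (shift x) n = cocSeq B m x (n + 1) := by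
  induction n with
  | zero => rfl
  | succ n ih => rw [cocSeq, ih]; rfl

theorem act_shift (m : ℤ) (x : InfPath A) :
    act B (coc B m (x.1 0)) (shift x) = shift (act B m x) := by
  apply Subtype.ext
  funext n
  change Katsura.act B (cocSeq B _ (shift x) n) _ = Katsura.act B _ _
  rw [cocSeq_shift]
  rfl

theorem cocSeq_add (m n : ℤ) (x : InfPath A) (i : ℕ) :
    cocSeq B (m + n) x i = cocSeq B m (act B n x) i + cocSeq B n x i := by
  induction i with
  | zero => rfl
  | succ i ih =>
    rw [cocSeq, ih, (act_coc_add B _ _ _).2]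
    rfl

theorem act_add (m n : ℤ) (x : InfPath A) : act B (m + n) x = act B m (act B n x) := by
  apply Subtype.ext
  funext i
  change Katsura.act B _ _ = Katsura.act B _ (Katsura.act B _ _)
  rw [cocSeq_add, (act_coc_add B _ _ _).1]

theorem cocSeq_zero (x : InfPath A) (i : ℕ) : cocSeq B 0 x i = 0 := by
  induction i with
  | zero => rfl
  | succ i ih => rw [cocSeq, ih, (act_coc_zero B _).2]

theorem act_zero (x : InfPath A) : act B 0 x = x := by
  apply Subtype.ext
  funext i
  change Katsura.act B _ _ = _
  rw [cocSeq_zero, (act_coc_zero B _).1]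

theorem ext_of {x y : InfPath A} (h0 : x.1 0 = y.1 0) (h : shift x = shift y) : x = y := by
  apply Subtype.ext
  funext n
  cases n with
  | zero => exact h0
  | succ n => exact congrFun (congrArg Subtype.val h) n

end InfPath

/-- `IsWalk v l w`: the edges in the list `l` form a path from `v` to `w`. -/
def IsWalk : Fin N → List (Edge A) → Fin N → Prop
  | v, [], w => v = w
  | v, e :: l, w => e.src = v ∧ IsWalk e.tgt l w

/-- The finite paths of the graph; those without edges are the vertices. -/
structure FinPath (A : Matrix (Fin N) (Fin N) ℤ) where
  src : Fin N
  tgt : Fin N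
  edges : List (Edge A)
  isWalk : IsWalk src edges tgt

theorem IsWalk.tgt_unique {v w w' : Fin N} {l : List (Edge A)} (h : IsWalk v l w)
    (h' : IsWalk v l w') : w = w' := by
  induction l generalizing v with
  | nil => exact h.symm.trans h'
  | cons e l ih => exact ih h.2 h'.2

theorem IsWalk.snoc {v w : Fin N} {l : List (Edge A)} (h : IsWalk v l w) (e : Edge A)
    (he : w = e.src) : IsWalk v (l ++ [e]) e.tgt := by
  induction l generalizing v with
  | nil => exact ⟨he.symm.trans (Eq.symm h), rfl⟩
  | cons f l ih => exact ⟨h.1, ih h.2⟩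

/-- The sequence that starts with the list `l` and continues with the sequence `y`. -/
def prepend {X : Type*} : List X → (ℕ → X) → ℕ → X
  | [], y => y
  | e :: l, y => fun n => Nat.casesOn n e (prepend l y)

theorem prepend_snoc {X : Type*} (l : List X) (y : ℕ → X) :
    prepend (l ++ [y 0]) (fun n => y (n + 1)) = prepend l y := by
  induction l with
  | nil =>
    funext n
    cases n <;> rfl
  | cons e l ih =>
    funext n
    cases n with
    | zero => rfl
    | succ n => exact congrFun ih n

theorem prepend_inj {X : Type*} {l l' : List X} {y y' : ℕ → X} (hl : l.length = l'.length)
    (h : prepend l y = prepend l' y') : l = l' ∧ y = y' := by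
  induction l generalizing l' with
  | nil =>
    cases l' with
    | nil => exact ⟨rfl, h⟩
    | cons e l' => simp at hl
  | cons e l ih =>
    cases l' with
    | nil => simp at hl
    | cons e' l' =>
      have h0 : e = e' := congrFun h 0
      have h1 : prepend l y = prepend l' y' := funext fun n => congrFun h (n + 1)
      obtain ⟨h2, h3⟩ := ih (by simpa using hl) h1
      exact ⟨by rw [h0, h2], h3⟩

theorem IsWalk.prepend_zero {v : Fin N} {l : List (Edge A)} {y : InfPath A}
    (h : IsWalk v l y.start) : (prepend l y.1 0).src = v := by
  cases l with
  | nil => exact Eq.symm h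
  | cons e l => exact h.1

theorem IsWalk.prepend_infPath {v : Fin N} {l : List (Edge A)} {y : InfPath A}
    (h : IsWalk v l y.start) (n : ℕ) :
    (prepend l y.1 n).tgt = (prepend l y.1 (n + 1)).src := by
  induction l generalizing v n with
  | nil => exact y.2 n
  | cons e l ih =>
    cases n with
    | zero => exact (IsWalk.prepend_zero h.2).symm
    | succ n => exact ih h.2 n

namespace FinPath

theorem ext_of {α β : FinPath A} (hs : α.src = β.src) (h : α.edges = β.edges) : α = β := by
  obtain ⟨s, t, l, w⟩ := α
  obtain ⟨s', t', l', w'⟩ := β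
  cases hs
  cases h
  cases w.tgt_unique w'
  rfl

/-- The path of length zero at a vertex. -/
def vertex (v : Fin N) : FinPath A := ⟨v, v, [], rfl⟩

/-- The finite path `α e`, for an edge `e` with source the range of `α`. -/
def snoc (α : FinPath A) (e : Edge A) (h : α.tgt = e.src) : FinPath A :=
  ⟨α.src, e.tgt, α.edges ++ [e], α.isWalk.snoc e h⟩

/-- The infinite path `α y`, for an infinite path `y` with source the range of `α`. -/
def append (α : FinPath A) (y : InfPath A) (h : α.tgt = y.start) : InfPath A :=
  ⟨prepend α.edges y.1, IsWalk.prepend_infPath (h ▸ α.isWalk)⟩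

/-- `Z(β)`, the set of all infinite paths of the form `β y`. -/
def cylinder (β : FinPath A) : Set (InfPath A) :=
  {x | ∃ (y : InfPath A) (h : β.tgt = y.start), x = β.append y h}

theorem append_snoc (α : FinPath A) (y : InfPath A) (h : α.tgt = y.start) :
    (α.snoc (y.1 0) h).append y.shift (InfPath.start_shift y).symm = α.append y h :=
  Subtype.ext (prepend_snoc α.edges y.1)

theorem start_append (α : FinPath A) (y : InfPath A) (h : α.tgt = y.start) :
    (α.append y h).start = α.src :=
  IsWalk.prepend_zero (h ▸ α.isWalk)

theorem append_inj {α β : FinPath A} {y z : InfPath A} {hα : α.tgt = y.start}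
    {hβ : β.tgt = z.start} (hl : α.edges.length = β.edges.length)
    (h : α.append y hα = β.append z hβ) : α = β ∧ y = z := by
  obtain ⟨h1, h2⟩ := prepend_inj hl (congrArg Subtype.val h)
  refine ⟨ext_of ?_ h1, Subtype.ext h2⟩
  rw [← start_append α y hα, h, start_append]

theorem snoc_inj {α β : FinPath A} {e f : Edge A} {hα : α.tgt = e.src} {hβ : β.tgt = f.src}
    (h : α.snoc e hα = β.snoc f hβ) : α = β ∧ e = f := by
  have h1 : α.edges ++ [e] = β.edges ++ [f] := congrArg FinPath.edges h
  have h2 : α.src = β.src := (congrArg FinPath.src h :)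
  obtain ⟨h3, h4⟩ := List.append_inj' h1 rfl
  exact ⟨ext_of h2 h3, by simpa using h4⟩

end FinPath

/-- The quadruples `(α, m, β; x)` with `α, β` finite paths with the same range, `m` an integer and
`x ∈ Z(β)`. The point `x = β y` is recorded through its tail `y`. -/
structure Quad (A : Matrix (Fin N) (Fin N) ℤ) where
  α : FinPath A
  m : ℤ
  β : FinPath A
  y : InfPath A
  hα : α.tgt = y.start
  hβ : β.tgt = y.start

namespace Quad

/-- The point `x = β y` of the quadruple `(α, m, β; x)`. -/
def pt (q : Quad A) : InfPath A := q.β.append q.y q.hβ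

/-- The infinite path `α κ_m(y)`. -/
def im (q : Quad A) : InfPath A := q.α.append (q.y.act B q.m) (q.hα.trans (InfPath.start_act B _ _).symm)

/-- For `x = β γ y'` with `γ` an edge, the quadruple `(α κ_m(γ), φ(m, γ), β γ; x)`. -/
def step (q : Quad A) : Quad A where
  α := q.α.snoc (act B q.m (q.y.1 0)) q.hα
  m := coc B q.m (q.y.1 0)
  β := q.β.snoc (q.y.1 0) q.hβ
  y := q.y.shift
  hα := (InfPath.start_shift q.y).symm
  hβ := (InfPath.start_shift q.y).symm

theorem ext_of {p q : Quad A} (h1 : p.α = q.α) (h2 : p.m = q.m) (h3 : p.β = q.β)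
    (h4 : p.y = q.y) : p = q := by
  cases p
  cases q
  cases h1
  cases h2
  cases h3
  cases h4
  rfl

theorem pt_step (q : Quad A) : (q.step B).pt = q.pt := FinPath.append_snoc q.β q.y q.hβ

theorem im_step (q : Quad A) : (q.step B).im B = q.im B := by
  refine Eq.trans (Subtype.ext ?_) (FinPath.append_snoc q.α (q.y.act B q.m) q.hα)
  change prepend _ (InfPath.act B (coc B q.m (q.y.1 0)) q.y.shift).1 = _
  rw [InfPath.act_shift]
  rfl

/-- The quadruple `(β, -m, α; α κ_m(y))`. -/
def inv (q : Quad A) : Quad A :=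
  ⟨q.β, -q.m, q.α, q.y.act B q.m, q.hβ.trans (InfPath.start_act B _ _).symm,
    q.hα.trans (InfPath.start_act B _ _).symm⟩

theorem inv_step (q : Quad A) : (q.step B).inv B = (q.inv B).step B := by
  have h := act_coc_add B (-q.m) q.m (q.y.1 0)
  rw [neg_add_cancel, (act_coc_zero B _).1, (act_coc_zero B _).2] at h
  apply ext_of
  · exact FinPath.ext_of rfl (congrArg (fun e => q.β.edges ++ [e]) h.1)
  · change -coc B q.m (q.y.1 0) = coc B (-q.m) (act B q.m (q.y.1 0))
    linarith [h.2]
  · rfl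
  · exact InfPath.act_shift B q.m q.y

/-- `p` and `q` are of the form `(α, m', β; β κ_m(y))` and `(β, m, γ; γ y)`. -/
def Matched (p q : Quad A) : Prop := p.β = q.α ∧ p.y = q.y.act B q.m

/-- The product `(α, m', β; β κ_m(y)) (β, m, γ; γ y) = (α, m' + m, γ; γ y)`. -/
def comp (p q : Quad A) (h : Matched B p q) : Quad A :=
  ⟨p.α, p.m + q.m, q.β, q.y, by rw [p.hα, h.2]; rfl, q.hβ⟩

theorem matched_step {p q : Quad A} : Matched B (p.step B) (q.step B) ↔ Matched B p q := by
  constructor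
  · rintro ⟨h1, h2⟩
    obtain ⟨h3, h4⟩ := FinPath.snoc_inj (f := act B q.m (q.y.1 0)) (hα := p.hβ) (hβ := q.hα) h1
    refine ⟨h3, InfPath.ext_of h4 ?_⟩
    rw [← InfPath.act_shift]
    exact h2
  · rintro ⟨h1, h2⟩
    constructor
    · refine FinPath.ext_of (congrArg FinPath.src h1 :) ?_
      change p.β.edges ++ [p.y.1 0] = q.α.edges ++ [act B q.m (q.y.1 0)]
      rw [h1, h2]
      rfl
    · change p.y.shift = InfPath.act B (coc B q.m (q.y.1 0)) q.y.shift
      rw [InfPath.act_shift, h2]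

theorem comp_step {p q : Quad A} (h : Matched B p q) (h' : Matched B (p.step B) (q.step B)) :
    comp B (p.step B) (q.step B) h' = (comp B p q h).step B := by
  have h1 : p.y.1 0 = act B q.m (q.y.1 0) := by rw [h.2]; rfl
  have h2 := act_coc_add B p.m q.m (q.y.1 0)
  refine ext_of ?_ ?_ rfl rfl
  · refine FinPath.ext_of rfl (congrArg (fun e => p.α.edges ++ [e]) ?_)
    change act B p.m (p.y.1 0) = act B (p.m + q.m) (q.y.1 0)
    rw [h1, h2.1]
  · change coc B p.m (p.y.1 0) + coc B q.m (q.y.1 0) = coc B (p.m + q.m) (q.y.1 0)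
    rw [h1, h2.2]

open Classical in
/-- The product of two quadruples that are matched, and a junk value otherwise. -/
noncomputable def compOr (p q : Quad A) : Quad A :=
  if h : Matched B p q then comp B p q h else p

/-- Refine one of the two quadruples until the two middle paths have the same length, then
multiply. -/
noncomputable def mul (p q : Quad A) : Quad A :=
  compOr B ((step B)^[q.α.edges.length - p.β.edges.length] p)
    ((step B)^[p.β.edges.length - q.α.edges.length] q)

end Quad

/-- The set underlying the Katsura-Exel-Pardo groupoid: the quadruples modulo the equivalence
relation generated by `(α, m, β; x) ∼ (α κ_m(γ), φ(m, γ), β γ; x)` for `x = β γ y'`. -/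
def KEP (A B : Matrix (Fin N) (Fin N) ℤ) : Type := Quot fun q q' : Quad A => q' = q.step B

namespace KEP

variable {B}

/-- The class `[α, m, β; x]` of a quadruple. -/
def mk (q : Quad A) : KEP A B := Quot.mk _ q

theorem mk_step (q : Quad A) : (mk (q.step B) : KEP A B) = mk q :=
  (Quot.sound (r := fun q q' : Quad A => q' = q.step B) rfl).symm

theorem mk_iterate (n : ℕ) (q : Quad A) : (mk ((Quad.step B)^[n] q) : KEP A B) = mk q := by
  induction n generalizing q with
  | zero => rfl
  | succ n ih => rw [Function.iterate_succ_apply, ih, mk_step]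

/-- The source of an arrow as an infinite path, `s([α, m, β; x]) = x`. -/
def s : KEP A B → InfPath A := Quot.lift Quad.pt (by rintro q _ rfl; exact (q.pt_step B).symm)

/-- The range of an arrow as an infinite path, `r([α, m, β; β y]) = α κ_m(y)`. -/
def r : KEP A B → InfPath A :=
  Quot.lift (Quad.im B) (by rintro q _ rfl; exact (q.im_step B).symm)

/-- The unit `[v, 0, v; x]`, where `v` is the source of `x`. -/
def unit (x : InfPath A) : KEP A B :=
  mk ⟨FinPath.vertex x.start, 0, FinPath.vertex x.start, x, rfl, rfl⟩

/-- The inverse `[α, m, β; β y]⁻¹ = [β, -m, α; α κ_m(y)]`. -/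
def inv : KEP A B → KEP A B :=
  Quot.lift (fun q => mk (q.inv B)) (by rintro q _ rfl; rw [Quad.inv_step, mk_step])

theorem mk_compOr_step (p q : Quad A) :
    (mk (Quad.compOr B (p.step B) (q.step B)) : KEP A B) = mk (Quad.compOr B p q) := by
  by_cases h : Quad.Matched B p q
  · have h' := (Quad.matched_step B).2 h
    rw [Quad.compOr, Quad.compOr, dif_pos h, dif_pos h', Quad.comp_step B h h', mk_step]
  · have h' := fun c => h ((Quad.matched_step B).1 c)
    rw [Quad.compOr, Quad.compOr, dif_neg h, dif_neg h', mk_step]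

theorem length_iterate (n : ℕ) (q : Quad A) :
    ((Quad.step B)^[n] q).α.edges.length = q.α.edges.length + n ∧
      ((Quad.step B)^[n] q).β.edges.length = q.β.edges.length + n := by
  induction n generalizing q with
  | zero => exact ⟨rfl, rfl⟩
  | succ n ih =>
    rw [Function.iterate_succ_apply, (ih _).1, (ih _).2]
    simp [Quad.step, FinPath.snoc]
    omega

theorem length_step (q : Quad A) :
    (q.step B).α.edges.length = q.α.edges.length + 1 ∧
      (q.step B).β.edges.length = q.β.edges.length + 1 :=
  length_iterate 1 q

theorem mk_mul_step_left (p q : Quad A) :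
    (mk (Quad.mul B (p.step B) q) : KEP A B) = mk (Quad.mul B p q) := by
  rw [Quad.mul, Quad.mul, (length_step p).2]
  by_cases h : q.α.edges.length ≤ p.β.edges.length
  · rw [Nat.sub_eq_zero_of_le h, Nat.sub_eq_zero_of_le (by omega : _ ≤ p.β.edges.length + 1),
      Nat.sub_add_comm h, Function.iterate_succ_apply']
    exact mk_compOr_step _ _
  · obtain ⟨k, hk⟩ : ∃ k, q.α.edges.length - p.β.edges.length = k + 1 :=
      ⟨q.α.edges.length - p.β.edges.length - 1, by omega⟩
    rw [hk, (by omega : q.α.edges.length - (p.β.edges.length + 1) = k),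
      (by omega : p.β.edges.length + 1 - q.α.edges.length = 0),
      (by omega : p.β.edges.length - q.α.edges.length = 0), Function.iterate_succ_apply]

theorem mk_mul_step_right (p q : Quad A) :
    (mk (Quad.mul B p (q.step B)) : KEP A B) = mk (Quad.mul B p q) := by
  rw [Quad.mul, Quad.mul, (length_step q).1]
  by_cases h : p.β.edges.length ≤ q.α.edges.length
  · rw [Nat.sub_eq_zero_of_le h, Nat.sub_eq_zero_of_le (by omega : _ ≤ q.α.edges.length + 1),
      Nat.sub_add_comm h, Function.iterate_succ_apply']
    exact mk_compOr_step _ _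
  · obtain ⟨k, hk⟩ : ∃ k, p.β.edges.length - q.α.edges.length = k + 1 :=
      ⟨p.β.edges.length - q.α.edges.length - 1, by omega⟩
    rw [hk, (by omega : p.β.edges.length - (q.α.edges.length + 1) = k),
      (by omega : q.α.edges.length + 1 - p.β.edges.length = 0),
      (by omega : q.α.edges.length - p.β.edges.length = 0), Function.iterate_succ_apply]

/-- The product of arrows (a junk value if they are not composable). It is the map with
`[α, m', β; β κ_m(y)] [β, m, γ; γ y] = [α, m' + m, γ; γ y]`, see `mul_mk`. -/
noncomputable def mul : KEP A B → KEP A B → KEP A B :=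
  Quot.lift₂ (fun p q => mk (Quad.mul B p q))
    (by rintro p q _ rfl; exact (mk_mul_step_right p q).symm)
    (by rintro p _ q rfl; exact (mk_mul_step_left p q).symm)

theorem mul_mk {p q : Quad A} (h : Quad.Matched B p q) :
    mul (mk p) (mk q) = (mk (Quad.comp B p q h) : KEP A B) := by
  change mk (Quad.mul B p q) = _
  rw [Quad.mul, h.1, Nat.sub_self, Quad.compOr]
  exact congrArg mk (dif_pos h)

theorem matched_iterate {p q : Quad A} (h : Quad.Matched B p q) (n : ℕ) :
    Quad.Matched B ((Quad.step B)^[n] p) ((Quad.step B)^[n] q) := by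
  induction n generalizing p q with
  | zero => exact h
  | succ n ih => exact ih ((Quad.matched_step B).2 h)

theorem matched_of {p q : Quad A} (hl : p.β.edges.length = q.α.edges.length)
    (h : p.pt = q.im B) : Quad.Matched B p q :=
  FinPath.append_inj hl h

theorem exists_matched (p q : Quad A) (h : s (mk p : KEP A B) = r (mk q : KEP A B)) :
    ∃ a b, Quad.Matched B ((Quad.step B)^[a] p) ((Quad.step B)^[b] q) := by
  refine ⟨q.α.edges.length, p.β.edges.length, matched_of ?_ ?_⟩
  · rw [(length_iterate _ _).1, (length_iterate _ _).2, add_comm]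
  · change s (mk _ : KEP A B) = r (mk _ : KEP A B)
    rw [mk_iterate, mk_iterate, h]

theorem exists_rep₂ (g h : KEP A B) (c : s g = r h) :
    ∃ p q, Quad.Matched B p q ∧ g = mk p ∧ h = mk q := by
  obtain ⟨p, rfl⟩ := Quot.exists_rep g
  obtain ⟨q, rfl⟩ := Quot.exists_rep h
  obtain ⟨a, b, hm⟩ := exists_matched p q c
  exact ⟨_, _, hm, (mk_iterate _ _).symm, (mk_iterate _ _).symm⟩

theorem exists_rep₃ (g h k : KEP A B) (c : s g = r h) (d : s h = r k) :
    ∃ p q t, Quad.Matched B p q ∧ Quad.Matched B q t ∧ g = mk p ∧ h = mk q ∧ k = mk t := by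
  obtain ⟨p, q, hm, rfl, rfl⟩ := exists_rep₂ g h c
  obtain ⟨t, rfl⟩ := Quot.exists_rep k
  obtain ⟨a, b, hm'⟩ := exists_matched q t d
  exact ⟨_, _, _, matched_iterate hm a, hm', (mk_iterate _ _).symm, (mk_iterate _ _).symm,
    (mk_iterate _ _).symm⟩

theorem s_unit (x : InfPath A) : s (unit x : KEP A B) = x := rfl

theorem r_unit (x : InfPath A) : r (unit x : KEP A B) = x := InfPath.act_zero B x

theorem unit_inj {x y : InfPath A} (h : (unit x : KEP A B) = unit y) : x = y :=
  congrArg s h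

theorem s_mul (g h : KEP A B) (c : s g = r h) : s (mul g h) = s h := by
  obtain ⟨p, q, hm, rfl, rfl⟩ := exists_rep₂ g h c
  rw [mul_mk hm]
  rfl

theorem r_mul (g h : KEP A B) (c : s g = r h) : r (mul g h) = r g := by
  obtain ⟨p, q, hm, rfl, rfl⟩ := exists_rep₂ g h c
  rw [mul_mk hm]
  apply Subtype.ext
  change prepend p.α.edges (InfPath.act B (p.m + q.m) q.y).1 = prepend p.α.edges _
  rw [InfPath.act_add, ← hm.2]

theorem s_inv (g : KEP A B) : s (inv g) = r g := by
  obtain ⟨p, rfl⟩ := Quot.exists_rep g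
  rfl

theorem r_inv (g : KEP A B) : r (inv g) = s g := by
  obtain ⟨p, rfl⟩ := Quot.exists_rep g
  apply Subtype.ext
  change prepend p.β.edges (InfPath.act B (-p.m) (InfPath.act B p.m p.y)).1 = prepend _ p.y.1
  rw [← InfPath.act_add, neg_add_cancel, InfPath.act_zero]

theorem mul_assoc (g h k : KEP A B) (c : s g = r h) (d : s h = r k) :
    mul (mul g h) k = mul g (mul h k) := by
  obtain ⟨p, q, t, h1, h2, rfl, rfl, rfl⟩ := exists_rep₃ g h k c d
  have h3 : Quad.Matched B (Quad.comp B p q h1) t := h2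
  have h4 : Quad.Matched B p (Quad.comp B q t h2) := by
    refine ⟨h1.1, ?_⟩
    rw [h1.2, h2.2]
    exact (InfPath.act_add B _ _ _).symm
  rw [mul_mk h1, mul_mk h2, mul_mk h3, mul_mk h4]
  exact congrArg mk (Quad.ext_of rfl (add_assoc _ _ _) rfl rfl)

/-- The class of `(α, 0, α; α y)` is a unit. -/
theorem mk_eq_unit (α : FinPath A) (y : InfPath A) (h : α.tgt = y.start) :
    (mk ⟨α, 0, α, y, h, h⟩ : KEP A B) = unit (α.append y h) := by
  have key : ∀ (n : ℕ) (α' : FinPath A) (z : InfPath A) (h' : α'.tgt = z.start),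
      ∃ α'' z' h'', (Quad.step B)^[n] ⟨α', 0, α', z, h', h'⟩ = ⟨α'', 0, α'', z', h'', h''⟩ := by
    intro n
    induction n with
    | zero => exact fun α' z h' => ⟨α', z, h', rfl⟩
    | succ n ih =>
      intro α' z h'
      obtain ⟨α'', z', h'', e⟩ := ih (α'.snoc (z.1 0) h') z.shift (InfPath.start_shift z).symm
      refine ⟨α'', z', h'', ?_⟩
      rw [Function.iterate_succ_apply, ← e]
      congr 1
      refine Quad.ext_of ?_ (act_coc_zero B _).2 rfl rfl
      exact FinPath.ext_of rfl (congrArg (fun e => α'.edges ++ [e]) (act_coc_zero B _).1)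
  set q : Quad A := ⟨FinPath.vertex (α.append y h).start, 0,
    FinPath.vertex (α.append y h).start, α.append y h, rfl, rfl⟩ with hq
  obtain ⟨α', z, h', e⟩ := key α.edges.length (FinPath.vertex (α.append y h).start)
    (α.append y h) rfl
  have e1 : (mk q : KEP A B) = mk ⟨α', 0, α', z, h', h'⟩ := by
    rw [← e, mk_iterate]
  have e2 : α'.edges.length = α.edges.length := by
    have := (length_iterate (B := B) α.edges.length q).1
    rw [hq, e] at this
    simpa [FinPath.vertex] using this
  have e3 : α'.append z h' = α.append y h := (congrArg s e1).symm
  obtain ⟨e4, e5⟩ := FinPath.append_inj e2 e3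
  subst e4
  subst e5
  exact e1.symm

theorem mul_unit (g : KEP A B) : mul g (unit (s g)) = g := by
  obtain ⟨p, rfl⟩ := Quot.exists_rep g
  have hm : Quad.Matched B p ⟨p.β, 0, p.β, p.y, p.hβ, p.hβ⟩ :=
    ⟨rfl, (InfPath.act_zero B _).symm⟩
  have h := mk_eq_unit (B := B) p.β p.y p.hβ
  refine Eq.trans (congrArg (mul (mk p)) h.symm) ((mul_mk hm).trans ?_)
  exact congrArg mk (Quad.ext_of rfl (add_zero _) rfl rfl)

theorem unit_mul (g : KEP A B) : mul (unit (r g)) g = g := by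
  obtain ⟨p, rfl⟩ := Quot.exists_rep g
  have hm : Quad.Matched B ⟨p.α, 0, p.α, p.y.act B p.m, p.hα, p.hα⟩ p := ⟨rfl, rfl⟩
  have h := mk_eq_unit (B := B) p.α (p.y.act B p.m) p.hα
  refine Eq.trans (congrArg (fun k => mul k (mk p)) h.symm) ((mul_mk hm).trans ?_)
  exact congrArg mk (Quad.ext_of rfl (zero_add _) rfl rfl)

theorem mul_inv (g : KEP A B) : mul g (inv g) = unit (r g) := by
  obtain ⟨p, rfl⟩ := Quot.exists_rep g
  have hm : Quad.Matched B p (p.inv B) := by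
    refine ⟨rfl, ?_⟩
    change p.y = InfPath.act B (-p.m) (InfPath.act B p.m p.y)
    rw [← InfPath.act_add, neg_add_cancel, InfPath.act_zero]
  refine (mul_mk hm).trans (Eq.trans ?_ (mk_eq_unit p.α (p.y.act B p.m) p.hα))
  exact congrArg mk (Quad.ext_of rfl (add_neg_cancel _) rfl rfl)

theorem inv_mul (g : KEP A B) : mul (inv g) g = unit (s g) := by
  obtain ⟨p, rfl⟩ := Quot.exists_rep g
  have hm : Quad.Matched B (p.inv B) p := ⟨rfl, rfl⟩
  refine (mul_mk hm).trans (Eq.trans ?_ (mk_eq_unit p.β p.y p.hβ))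
  exact congrArg mk (Quad.ext_of rfl (neg_add_cancel _) rfl rfl)

/-- The Katsura-Exel-Pardo groupoid. -/
noncomputable instance : ArrowGroupoid (KEP A B) where
  src g := unit (s g)
  rng g := unit (r g)
  inv := inv
  mul g h _ := mul g h
  src_src _ := rfl
  rng_src g := congrArg unit (r_unit (s g))
  src_rng _ := rfl
  rng_rng g := congrArg unit (r_unit (r g))
  src_mul g h c := congrArg unit (s_mul g h (unit_inj c))
  rng_mul g h c := congrArg unit (r_mul g h (unit_inj c))
  mul_assoc g h k c d := mul_assoc g h k (unit_inj c) (unit_inj d)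
  mul_src := mul_unit
  rng_mul_self := unit_mul
  src_inv g := congrArg unit (s_inv g)
  rng_inv g := congrArg unit (r_inv g)
  mul_inv := mul_inv
  inv_mul := inv_mul

/-- `Z(α, m, β; U)`, the set of all `[α, m, β; x]` with `x ∈ U`. -/
def basicSet (α : FinPath A) (m : ℤ) (β : FinPath A) (U : Set (InfPath A)) : Set (KEP A B) :=
  {g | ∃ q : Quad A, q.α = α ∧ q.m = m ∧ q.β = β ∧ q.pt ∈ U ∧ g = mk q}

/-- The topology generated by the sets `Z(α, m, β; U)`, where `α` and `β` have the same range and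
`U` is a compact open subset of `Z(β)`. -/
instance : TopologicalSpace (KEP A B) :=
  TopologicalSpace.generateFrom
    {V | ∃ (α : FinPath A) (m : ℤ) (β : FinPath A) (U : Set (InfPath A)), α.tgt = β.tgt ∧
      IsCompact U ∧ IsOpen U ∧ U ⊆ β.cylinder ∧ V = basicSet α m β U}

end KEP

end Katsura

/-! ### Functionals on functions from harmonic weights on a tree of sets -/

/-- The indicator function of a set, with rational values. -/
noncomputable def ind {X : Type*} (U : Set X) : X → ℚ := U.indicator 1

theorem ind_of_mem {X : Type*} {U : Set X} {x : X} (h : x ∈ U) : ind U x = 1 := by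
  simp [ind, h]

theorem ind_of_notMem {X : Type*} {U : Set X} {x : X} (h : x ∉ U) : ind U x = 0 := by
  simp [ind, h]

/-- The indicator function of a set covered by a family of sets, each point being in exactly one
of them. -/
theorem ind_eq_sum {X ι : Type*} (F : Finset ι) (C : ι → Set X) (U : Set X)
    (hC : ∀ i ∈ F, C i ⊆ U) (hU : ∀ x ∈ U, ∃ i ∈ F, x ∈ C i)
    (hd : ∀ i ∈ F, ∀ j ∈ F, ∀ x ∈ C i, x ∈ C j → i = j) :
    ind U = ∑ i ∈ F, ind (C i) := by
  funext x
  rw [Finset.sum_apply]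
  by_cases hx : x ∈ U
  · obtain ⟨i, hi, hxi⟩ := hU x hx
    rw [Finset.sum_eq_single_of_mem i hi, ind_of_mem hx, ind_of_mem hxi]
    intro j hj hji
    exact ind_of_notMem fun hxj => hji (hd j hj i hi x hxj hxi)
  · rw [ind_of_notMem hx, Finset.sum_eq_zero]
    exact fun i hi => ind_of_notMem fun hxi => hx (hC i hi hxi)

/-- A tree of nonempty subsets of `X`: every set is the disjoint union of the sets of its finitely
many children, and distinct sets of the same level are disjoint. -/
structure SetTree (X T : Type*) where
  cell : T → Set X
  level : T → ℕ
  Index : T → Type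
  fintype : ∀ t, Fintype (Index t)
  child : ∀ t, Index t → T
  cell_nonempty : ∀ t, (cell t).Nonempty
  cell_child : ∀ t i, cell (child t i) ⊆ cell t
  exists_child : ∀ t, ∀ x ∈ cell t, ∃ i, x ∈ cell (child t i)
  level_child : ∀ t i, level (child t i) = level t + 1
  child_injective : ∀ t, Function.Injective (child t)
  eq_of_mem : ∀ t t', level t = level t' → ∀ x ∈ cell t, x ∈ cell t' → t = t'

namespace SetTree

variable {X T : Type*} (𝒯 : SetTree X T)

instance (t : T) : Fintype (𝒯.Index t) := 𝒯.fintype t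

theorem ind_cell (t : T) : ind (𝒯.cell t) = ∑ i, ind (𝒯.cell (𝒯.child t i)) := by
  refine ind_eq_sum _ _ _ (fun i _ => 𝒯.cell_child t i) (fun x hx => ?_) ?_
  · obtain ⟨i, hi⟩ := 𝒯.exists_child t x hx
    exact ⟨i, Finset.mem_univ _, hi⟩
  · intro i _ j _ x hi hj
    exact 𝒯.child_injective t (𝒯.eq_of_mem _ _ (by rw [level_child, level_child]) x hi hj)

/-- A weight on a tree of sets is harmonic if it is the sum of the weights of the children. -/
def IsHarmonic (w : T → ℚ) : Prop := ∀ t, w t = ∑ i, w (𝒯.child t i)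

theorem isHarmonic_ind (l : (X → ℚ) →ₗ[ℚ] ℚ) : 𝒯.IsHarmonic fun t => l (ind (𝒯.cell t)) := by
  intro t
  simp only
  rw [𝒯.ind_cell t, map_sum]

theorem exists_level_eq (t : T) (x : X) (hx : x ∈ 𝒯.cell t) (P : T → Prop) (hP : P t)
    (hc : ∀ t i, P t → P (𝒯.child t i)) (k : ℕ) :
    ∃ t', 𝒯.level t' = 𝒯.level t + k ∧ x ∈ 𝒯.cell t' ∧ 𝒯.cell t' ⊆ 𝒯.cell t ∧ P t' := by
  induction k with
  | zero => exact ⟨t, rfl, hx, subset_rfl, hP⟩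
  | succ k ih =>
    obtain ⟨t', h1, h2, h3, h4⟩ := ih
    obtain ⟨i, hi⟩ := 𝒯.exists_child t' x h2
    exact ⟨_, by rw [level_child, h1, add_assoc], hi, (𝒯.cell_child t' i).trans h3, hc t' i h4⟩

/-- A compact set which is a union of open cells is a finite disjoint union of cells of the same
level; these cells can be chosen with any property that is inherited by children. -/
theorem exists_finset_of_isCompact [TopologicalSpace X] {U : Set X} (hU : IsCompact U)
    (P : T → Prop) (hc : ∀ t i, P t → P (𝒯.child t i)) (hopen : ∀ t, IsOpen (𝒯.cell t))
    (h : ∀ x ∈ U, ∃ t, x ∈ 𝒯.cell t ∧ 𝒯.cell t ⊆ U ∧ P t) :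
    ∃ F : Finset T, (∀ t ∈ F, 𝒯.cell t ⊆ U) ∧ (∀ x ∈ U, ∃ t ∈ F, x ∈ 𝒯.cell t) ∧
      (∀ t ∈ F, ∀ t' ∈ F, ∀ x ∈ 𝒯.cell t, x ∈ 𝒯.cell t' → t = t') ∧ ∀ t ∈ F, P t := by
  classical
  obtain ⟨F, hF⟩ := hU.elim_finite_subcover
    (fun t : {t // 𝒯.cell t ⊆ U ∧ P t} => 𝒯.cell t.1) (fun t => hopen t.1) (fun x hx => by
      obtain ⟨t, h1, h2⟩ := h x hx
      exact Set.mem_iUnion.2 ⟨⟨t, h2⟩, h1⟩)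
  set n := F.sup fun t => 𝒯.level t.1 with hn
  obtain ⟨F', hF'⟩ := hU.elim_finite_subcover
    (fun t : {t // 𝒯.level t = n ∧ 𝒯.cell t ⊆ U ∧ P t} => 𝒯.cell t.1) (fun t => hopen t.1)
    (fun x hx => by
      obtain ⟨t, ht, hxt⟩ := Set.mem_iUnion₂.1 (hF hx)
      have hle : 𝒯.level t.1 ≤ n := Finset.le_sup (f := fun t => 𝒯.level t.1) ht
      obtain ⟨t', h1, h2, h3, h4⟩ := 𝒯.exists_level_eq t.1 x hxt P t.2.2 hc (n - 𝒯.level t.1)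
      exact Set.mem_iUnion.2 ⟨⟨t', by omega, h3.trans t.2.1, h4⟩, h2⟩)
  refine ⟨F'.image Subtype.val, ?_, ?_, ?_, ?_⟩
  · intro t ht
    obtain ⟨t, -, rfl⟩ := Finset.mem_image.1 ht
    exact t.2.2.1
  · intro x hx
    obtain ⟨t, ht, hxt⟩ := Set.mem_iUnion₂.1 (hF' hx)
    exact ⟨t.1, Finset.mem_image_of_mem _ ht, hxt⟩
  · intro t ht t' ht' x hx hx'
    obtain ⟨t, -, rfl⟩ := Finset.mem_image.1 ht
    obtain ⟨t', -, rfl⟩ := Finset.mem_image.1 ht'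
    exact 𝒯.eq_of_mem _ _ (by rw [t.2.1, t'.2.1]) x hx hx'
  · intro t ht
    obtain ⟨t, -, rfl⟩ := Finset.mem_image.1 ht
    exact t.2.2.2

/-- Formal combinations of cells can be rewritten as combinations of cells of one level. -/
theorem exists_finsupp_level (n : ℕ) (t : T) (h : 𝒯.level t ≤ n) :
    ∃ y : T →₀ ℚ, (∀ t' ∈ y.support, 𝒯.level t' = n) ∧
      Finsupp.linearCombination ℚ (fun t => ind (𝒯.cell t)) y = ind (𝒯.cell t) ∧
      ∀ w, 𝒯.IsHarmonic w → Finsupp.linearCombination ℚ w y = w t := by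
  classical
  obtain ⟨k, rfl⟩ := Nat.exists_eq_add_of_le h
  induction k generalizing t with
  | zero =>
    refine ⟨Finsupp.single t 1, fun t' ht' => ?_, by simp, fun w _ => by simp⟩
    rw [Finset.mem_singleton.1 (Finsupp.support_single_subset ht')]
    rfl
  | succ k ih =>
    have h' : ∀ i, 𝒯.level (𝒯.child t i) + k = 𝒯.level t + (k + 1) := fun i => by
      rw [level_child]; omega
    choose y hy using fun i => ih (𝒯.child t i) (by omega)
    refine ⟨∑ i, y i, fun t' ht' => ?_, ?_, fun w hw => ?_⟩
    · obtain ⟨i, -, hi⟩ := Finset.mem_biUnion.1 (Finsupp.support_finsetSum ht')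
      rw [← h' i]
      exact (hy i).1 t' hi
    · rw [map_sum, 𝒯.ind_cell t]
      exact Finset.sum_congr rfl fun i _ => (hy i).2.1
    · rw [map_sum, hw t]
      exact Finset.sum_congr rfl fun i _ => (hy i).2.2 w hw

/-- Every harmonic weight on a tree of sets comes from a linear functional. -/
theorem IsHarmonic.exists_functional {w : T → ℚ} (hw : 𝒯.IsHarmonic w) :
    ∃ l : (X → ℚ) →ₗ[ℚ] ℚ, ∀ t, l (ind (𝒯.cell t)) = w t := by
  classical
  set L := Finsupp.linearCombination ℚ (fun t => ind (𝒯.cell t)) with hL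
  set W := Finsupp.linearCombination ℚ w with hW
  have key : LinearMap.ker L ≤ LinearMap.ker W := by
    intro x hx
    set n := x.support.sup 𝒯.level
    have hle : ∀ t : x.support, 𝒯.level t.1 ≤ n := fun t => Finset.le_sup t.2
    choose y hy using fun t : x.support => 𝒯.exists_finsupp_level n t.1 (hle t)
    set z : T →₀ ℚ := ∑ t : x.support, x t.1 • y t with hz
    have hLz : L z = L x := by
      rw [hz, map_sum, hL, Finsupp.linearCombination_apply, Finsupp.sum]
      refine Eq.trans ?_ (Finset.sum_coe_sort _ _)
      exact Finset.sum_congr rfl fun t _ => by rw [map_smul, (hy t).2.1]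
    have hWz : W z = W x := by
      rw [hz, map_sum, hW, Finsupp.linearCombination_apply, Finsupp.sum]
      refine Eq.trans ?_ (Finset.sum_coe_sort _ _)
      exact Finset.sum_congr rfl fun t _ => by rw [map_smul, (hy t).2.2 w hw]
    have hlev : ∀ t ∈ z.support, 𝒯.level t = n := by
      intro t ht
      obtain ⟨i, -, hi⟩ := Finset.mem_biUnion.1 (Finsupp.support_finsetSum ht)
      exact (hy i).1 t (Finsupp.support_smul hi)
    have hz0 : z = 0 := by
      by_contra hne
      obtain ⟨t, ht⟩ := Finsupp.support_nonempty_iff.2 hne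
      obtain ⟨p, hp⟩ := 𝒯.cell_nonempty t
      have h0 : L z p = 0 := by rw [hLz, LinearMap.mem_ker.1 hx]; rfl
      rw [hL, Finsupp.linearCombination_apply, Finsupp.sum, Finset.sum_apply,
        Finset.sum_eq_single_of_mem t ht] at h0
      · rw [Pi.smul_apply, ind_of_mem hp, smul_eq_mul, mul_one] at h0
        exact Finsupp.mem_support_iff.1 ht h0
      · intro t' ht' hne'
        rw [Pi.smul_apply, ind_of_notMem, smul_zero]
        exact fun hp' => hne' (𝒯.eq_of_mem _ _ ((hlev _ ht').trans (hlev _ ht).symm) p hp' hp)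
    rw [LinearMap.mem_ker, ← hWz, hz0, map_zero]
  have hmem : W ∈ LinearMap.range L.dualMap := by
    rw [LinearMap.range_dualMap_eq_dualAnnihilator_ker, Submodule.mem_dualAnnihilator]
    exact fun x hx => LinearMap.mem_ker.1 (key hx)
  obtain ⟨l, hl⟩ := hmem
  refine ⟨l, fun t => ?_⟩
  have h := LinearMap.congr_fun hl (Finsupp.single t 1)
  simpa [hL, hW] using h

end SetTree

/-! ### Kernels of integer matrices -/

section Kernels

/-- The kernel of an integer matrix has the same rank as the kernel over the rationals. -/
theorem finrank_ker_map_intCast {n : Type*} [Fintype n] (M : Matrix n n ℤ) :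
    Module.finrank ℚ (LinearMap.ker (M.map (Int.cast : ℤ → ℚ)).mulVecLin) =
      Module.finrank ℤ (LinearMap.ker M.mulVecLin) := by
  have hcast : ∀ x : n → ℤ, (M.map (Int.cast : ℤ → ℚ)).mulVec (fun i => (x i : ℚ)) =
      fun i => ((M.mulVec x i : ℤ) : ℚ) := by
    intro x
    funext i
    simp [Matrix.mulVec, dotProduct]
  let f : LinearMap.ker M.mulVecLin →ₗ[ℤ] LinearMap.ker (M.map (Int.cast : ℤ → ℚ)).mulVecLin :=
    { toFun := fun x => ⟨fun i => (x.1 i : ℚ), by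
        have hx : M.mulVec x.1 = 0 := x.2
        rw [LinearMap.mem_ker, Matrix.mulVecLin_apply, hcast, hx]
        simp; rfl⟩
      map_add' := fun x y => by ext i; simp
      map_smul' := fun c x => by ext i; simp }
  have hf : IsLocalizedModule (nonZeroDivisors ℤ) f := by
    refine ⟨fun s => ?_, fun y => ?_, fun {x y} h => ⟨1, ?_⟩⟩
    · have hs : (s.1 : ℚ) ≠ 0 := by exact_mod_cast nonZeroDivisors.ne_zero s.2
      rw [Module.End.isUnit_iff]
      constructor
      · intro x y h
        have h' : (s.1 : ℤ) • x = (s.1 : ℤ) • y := h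
        rw [← Int.cast_smul_eq_zsmul ℚ, ← Int.cast_smul_eq_zsmul ℚ] at h'
        exact smul_right_injective _ hs h'
      · intro y
        refine ⟨(s.1 : ℚ)⁻¹ • y, ?_⟩
        change (s.1 : ℤ) • ((s.1 : ℚ)⁻¹ • y) = y
        rw [← Int.cast_smul_eq_zsmul ℚ, smul_inv_smul₀ hs]
    · obtain ⟨b, hb⟩ := IsLocalization.exist_integer_multiples_of_finite (nonZeroDivisors ℤ) y.1
      choose x hx using hb
      have hx' : (fun i => (x i : ℚ)) = (b.1 : ℚ) • y.1 := by
        funext i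
        have := hx i
        simp only [eq_intCast, zsmul_eq_mul] at this
        simpa using this
      refine ⟨⟨⟨x, ?_⟩, b⟩, ?_⟩
      · have h0 := hcast x
        have hy : (M.map (Int.cast : ℤ → ℚ)).mulVec y.1 = 0 := y.2
        rw [hx', Matrix.mulVec_smul, hy, smul_zero] at h0
        rw [LinearMap.mem_ker, Matrix.mulVecLin_apply]
        funext i
        have := congrFun h0 i
        exact Int.cast_eq_zero.1 this.symm
      · apply Subtype.ext
        change (b.1 : ℤ) • y.1 = fun i => (x i : ℚ)
        rw [hx', Int.cast_smul_eq_zsmul]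
    · congr 1
      apply Subtype.ext
      funext i
      have := congrFun (congrArg Subtype.val h) i
      exact Int.cast_injective (α := ℚ) this
  rw [IsFractionRing.finrank_right_eq ℤ]
  exact IsLocalizedModule.finrank_eq (nonZeroDivisors ℤ) f le_rfl

theorem nonempty_ker_addEquiv {n n' : Type*} [Fintype n] [Fintype n'] {M : Matrix n n ℤ}
    {M' : Matrix n' n' ℤ}
    (h : Module.finrank ℚ (LinearMap.ker (M.map (Int.cast : ℤ → ℚ)).mulVecLin) =
      Module.finrank ℚ (LinearMap.ker (M'.map (Int.cast : ℤ → ℚ)).mulVecLin)) :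
    Nonempty (LinearMap.ker M.mulVecLin ≃+ LinearMap.ker M'.mulVecLin) := by
  rw [finrank_ker_map_intCast, finrank_ker_map_intCast] at h
  exact ⟨(LinearEquiv.ofFinrankEq _ _ h).toAddEquiv⟩

/-- If `V` is closed under passing along nonzero entries of `M`, and all nonzero entries of some
power of `M` are in columns in `V`, then the fixed vectors of `M` are those of its restriction
to `V`. -/
theorem finrank_ker_one_sub_submatrix {n : Type*} [Fintype n] [DecidableEq n]
    (M : Matrix n n ℚ) (V : Set n) [Fintype V] (hV : ∀ i ∈ V, ∀ j, M i j ≠ 0 → j ∈ V) (L : ℕ)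
    (hL : ∀ i j, (M ^ L) i j ≠ 0 → j ∈ V) :
    Module.finrank ℚ (LinearMap.ker (1 - M).mulVecLin) =
      Module.finrank ℚ (LinearMap.ker
        (1 - M.submatrix (Subtype.val : V → n) (Subtype.val : V → n)).mulVecLin) := by
  classical
  have hker : ∀ x, x ∈ LinearMap.ker (1 - M).mulVecLin ↔ M.mulVec x = x := fun x => by
    rw [LinearMap.mem_ker, Matrix.mulVecLin_apply, Matrix.sub_mulVec, Matrix.one_mulVec,
      sub_eq_zero, eq_comm]
  have hker' : ∀ x, x ∈ LinearMap.ker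
      (1 - M.submatrix (Subtype.val : V → n) (Subtype.val : V → n)).mulVecLin ↔
      (M.submatrix (Subtype.val : V → n) (Subtype.val : V → n)).mulVec x = x := fun x => by
    rw [LinearMap.mem_ker, Matrix.mulVecLin_apply, Matrix.sub_mulVec, Matrix.one_mulVec,
      sub_eq_zero, eq_comm]
  have hres : ∀ (x : n → ℚ) (v : V), (M.submatrix (Subtype.val : V → n) (Subtype.val : V → n)).mulVec
      (fun v : V => x v) v = M.mulVec x v := by
    intro x v
    simp only [Matrix.mulVec, dotProduct, Matrix.submatrix_apply]
    rw [← Finset.sum_subtype (Finset.univ.filter (· ∈ V)) (by simp) (fun j => M v j * x j)]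
    refine Finset.sum_subset (Finset.filter_subset _ _) fun j _ hj => ?_
    have : M v j = 0 := by
      by_contra h
      exact hj (by simpa using hV v v.2 j h)
    rw [this, zero_mul]
  have hpow : ∀ x y : n → ℚ, (∀ v ∈ V, x v = y v) → (M ^ L).mulVec x = (M ^ L).mulVec y := by
    intro x y hxy
    funext i
    refine Finset.sum_congr rfl fun j _ => ?_
    by_cases h : (M ^ L) i j = 0
    · simp [h]
    · rw [hxy j (hL i j h)]
  have hfix : ∀ x, M.mulVec x = x → ∀ k, (M ^ k).mulVec x = x := by
    intro x hx k
    induction k with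
    | zero => simp
    | succ k ih => rw [pow_succ, ← Matrix.mulVec_mulVec, hx, ih]
  let f : LinearMap.ker (1 - M).mulVecLin →ₗ[ℚ] LinearMap.ker
      (1 - M.submatrix (Subtype.val : V → n) (Subtype.val : V → n)).mulVecLin :=
    { toFun := fun x => ⟨fun v => x.1 v, by
        rw [hker']
        funext v
        rw [hres, (hker _).1 x.2]⟩
      map_add' := fun x y => rfl
      map_smul' := fun c x => rfl }
  refine (LinearEquiv.ofBijective f ⟨fun x y h => ?_, fun y => ?_⟩).finrank_eq
  · apply Subtype.ext
    rw [← hfix x.1 ((hker _).1 x.2) L, ← hfix y.1 ((hker _).1 y.2) L]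
    exact hpow _ _ fun v hv => congrFun (congrArg Subtype.val h) ⟨v, hv⟩
  · set z : n → ℚ := fun i => if h : i ∈ V then y.1 ⟨i, h⟩ else 0 with hz
    have hzy : (fun v : V => z v) = y.1 := by
      funext v
      simp [hz]
    have hMz : ∀ x : n → ℚ, (fun v : V => x v) = y.1 → (fun v : V => M.mulVec x v) = y.1 := by
      intro x hx
      funext v
      rw [← hres, hx, (hker' _).1 y.2]
    have hMk : ∀ k, (fun v : V => (M ^ k).mulVec z v) = y.1 := by
      intro k
      induction k with
      | zero => simpa using hzy
      | succ k ih =>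
        rw [pow_succ', ← Matrix.mulVec_mulVec]
        exact hMz _ ih
    refine ⟨⟨(M ^ L).mulVec z, (hker _).2 ?_⟩, Subtype.ext (hMk L)⟩
    rw [Matrix.mulVec_mulVec, ← pow_succ', pow_succ, ← Matrix.mulVec_mulVec]
    apply hpow
    intro v hv
    have h1 := congrFun (hMz z hzy) ⟨v, hv⟩
    have h2 := congrFun hzy ⟨v, hv⟩
    exact h1.trans h2.symm

theorem finrank_quotient_range {n : Type*} [Fintype n] (M : Matrix n n ℚ) :
    Module.finrank ℚ ((n → ℚ) ⧸ LinearMap.range M.mulVecLin) =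
      Module.finrank ℚ (LinearMap.ker M.mulVecLin) := by
  have h1 := Submodule.finrank_quotient_add_finrank (LinearMap.range M.mulVecLin)
  have h2 := LinearMap.finrank_range_add_finrank_ker M.mulVecLin
  omega

end Kernels

/-! ### Invariants of topological groupoids -/

theorem finrank_quotient_eq {M M' : Type*} [AddCommGroup M] [AddCommGroup M'] [Module ℚ M]
    [Module ℚ M'] (f : M ≃ₗ[ℚ] M') {p q : Submodule ℚ M} {p' q' : Submodule ℚ M'}
    (hp : ∀ x, f x ∈ p' ↔ x ∈ p) (hq : ∀ x, f x ∈ q' ↔ x ∈ q) :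
    Module.finrank ℚ (p ⧸ q.submoduleOf p) = Module.finrank ℚ (p' ⧸ q'.submoduleOf p') := by
  have hp' : p.map (f : M →ₗ[ℚ] M') = p' := by
    ext y
    obtain ⟨x, rfl⟩ := f.surjective y
    simp [hp]
  refine (Submodule.Quotient.equiv _ _ (LinearEquiv.ofSubmodules f p p' hp') ?_).finrank_eq
  ext y
  obtain ⟨x, rfl⟩ := (LinearEquiv.ofSubmodules f p p' hp').surjective y
  rw [Submodule.mem_map_equiv, LinearEquiv.symm_apply_apply]
  exact (hq x.1).symm

namespace ArrowGroupoid

/-- The set of all products of composable arrows from two sets. -/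
def mulSet {G : Type*} [ArrowGroupoid G] (U V : Set G) : Set G :=
  {k | ∃ g ∈ U, ∃ h ∈ V, ∃ c : src g = rng h, k = mul g h c}

section Invariants

variable (G : Type*) [ArrowGroupoid G] [TopologicalSpace G]

variable {G} in
/-- Compact open bisections: compact open sets of arrows on which source and range are
injective. -/
structure IsCompactOpenBisection (U : Set G) : Prop where
  isCompact : IsCompact U
  isOpen : IsOpen U
  src_injOn : Set.InjOn src U
  rng_injOn : Set.InjOn rng U

/-- The functionals which are additive on products of matching bisections. -/
def cocycles : Submodule ℚ ((G → ℚ) →ₗ[ℚ] ℚ) where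
  carrier := {l | ∀ U V : Set G, IsCompactOpenBisection U → IsCompactOpenBisection V →
    src '' U = rng '' V → l (ind (mulSet U V)) = l (ind U) + l (ind V)}
  zero_mem' := fun U V _ _ _ => by simp
  add_mem' := fun {l l'} h h' U V hU hV e => by
    rw [LinearMap.add_apply, LinearMap.add_apply, LinearMap.add_apply, h U V hU hV e,
      h' U V hU hV e]
    ring
  smul_mem' := fun c l h U V hU hV e => by
    rw [LinearMap.smul_apply, LinearMap.smul_apply, LinearMap.smul_apply, h U V hU hV e, smul_add]

/-- The functionals which are on bisections the difference of a functional at source and range. -/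
def coboundaries : Submodule ℚ ((G → ℚ) →ₗ[ℚ] ℚ) where
  carrier := {l | ∃ k : (G → ℚ) →ₗ[ℚ] ℚ, ∀ U : Set G, IsCompactOpenBisection U →
    l (ind U) = k (ind (src '' U)) - k (ind (rng '' U))}
  zero_mem' := ⟨0, fun U _ => by simp⟩
  add_mem' := fun {l l'} ⟨k, h⟩ ⟨k', h'⟩ => ⟨k + k', fun U hU => by
    rw [LinearMap.add_apply, LinearMap.add_apply, LinearMap.add_apply, h U hU, h' U hU]
    ring⟩
  smul_mem' := fun c l ⟨k, h⟩ => ⟨c • k, fun U hU => by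
    rw [LinearMap.smul_apply, LinearMap.smul_apply, LinearMap.smul_apply, h U hU, smul_sub]⟩

/-- The functionals which agree on the sources and the ranges of bisections. -/
def invariants : Submodule ℚ ((G → ℚ) →ₗ[ℚ] ℚ) where
  carrier := {l | ∀ U : Set G, IsCompactOpenBisection U →
    l (ind (src '' U)) = l (ind (rng '' U))}
  zero_mem' := fun U _ => by simp
  add_mem' := fun {l l'} h h' U hU => by
    rw [LinearMap.add_apply, LinearMap.add_apply, h U hU, h' U hU]
  smul_mem' := fun c l h U hU => by
    rw [LinearMap.smul_apply, LinearMap.smul_apply, h U hU]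

/-- The functionals which vanish on the sources of bisections. -/
def nullFunctionals : Submodule ℚ ((G → ℚ) →ₗ[ℚ] ℚ) where
  carrier := {l | ∀ U : Set G, IsCompactOpenBisection U → l (ind (src '' U)) = 0}
  zero_mem' := fun U _ => by simp
  add_mem' := fun {l l'} h h' U hU => by
    rw [LinearMap.add_apply, h U hU, h' U hU, add_zero]
  smul_mem' := fun c l h U hU => by
    rw [LinearMap.smul_apply, h U hU, smul_zero]

/-- The dimension of the space of invariant finitely additive measures on the unit space. -/
noncomputable def invariantDim : ℕ :=
  Module.finrank ℚ (invariants G ⧸ (nullFunctionals G).submoduleOf (invariants G))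

/-- The dimension of the space of cocycles modulo coboundaries. -/
noncomputable def cocycleDim : ℕ :=
  Module.finrank ℚ (cocycles G ⧸ (coboundaries G).submoduleOf (cocycles G))

end Invariants

theorem eq_src_of_mul_eq {G : Type*} [ArrowGroupoid G] {g h : G} (c : src g = rng h)
    (e : mul g h c = g) : h = src g := by
  have h1 := mul_assoc (inv g) g h (src_inv g) c
  have h2 : mul (inv g) (mul g h c) ((src_inv g).trans (rng_mul g h c).symm) =
      mul (inv g) g (src_inv g) := by congr 1
  have h3 : mul (mul (inv g) g (src_inv g)) h ((src_mul _ _ _).trans c) =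
      mul (rng h) h (src_rng h) := by
    congr 1
    rw [inv_mul, c]
  rw [h2, h3, rng_mul_self, inv_mul] at h1
  exact h1

namespace TopIso

variable {G H : Type*} [ArrowGroupoid G] [ArrowGroupoid H] [TopologicalSpace G]
  [TopologicalSpace H] (e : TopIso G H)

theorem map_src (g : G) : e.toHomeomorph (src g) = src (e.toHomeomorph g) := by
  refine eq_src_of_mul_eq ((e.composable_iff _ _).1 (rng_src g).symm) ?_
  exact (e.map_mul _ _ (rng_src g).symm).symm.trans (congrArg e.toHomeomorph (mul_src g))

theorem map_rng (g : G) : e.toHomeomorph (rng g) = rng (e.toHomeomorph g) := by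
  have h : src (e.toHomeomorph (rng g)) = rng (e.toHomeomorph g) :=
    (e.composable_iff _ _).1 (src_rng g)
  rw [← h, ← e.map_src, src_rng]

theorem image_src (U : Set G) : e.toHomeomorph '' (src '' U) = src '' (e.toHomeomorph '' U) := by
  rw [Set.image_image, Set.image_image]
  exact Set.image_congr fun g _ => e.map_src g

theorem image_rng (U : Set G) : e.toHomeomorph '' (rng '' U) = rng '' (e.toHomeomorph '' U) := by
  rw [Set.image_image, Set.image_image]
  exact Set.image_congr fun g _ => e.map_rng g

theorem image_mulSet (U V : Set G) :
    e.toHomeomorph '' (mulSet U V) = mulSet (e.toHomeomorph '' U) (e.toHomeomorph '' V) := by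
  ext k
  constructor
  · rintro ⟨_, ⟨g, hg, h, hh, c, rfl⟩, rfl⟩
    exact ⟨_, ⟨g, hg, rfl⟩, _, ⟨h, hh, rfl⟩, (e.composable_iff g h).1 c, e.map_mul g h c⟩
  · rintro ⟨_, ⟨g, hg, rfl⟩, _, ⟨h, hh, rfl⟩, c, rfl⟩
    have c' := (e.composable_iff g h).2 c
    exact ⟨_, ⟨g, hg, h, hh, c', rfl⟩, e.map_mul g h c'⟩

theorem isCompactOpenBisection_image {U : Set G} :
    IsCompactOpenBisection (e.toHomeomorph '' U) ↔ IsCompactOpenBisection U := by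
  have hs : Set.InjOn src (e.toHomeomorph '' U) ↔ Set.InjOn src U := by
    constructor
    · intro h x hx y hy hxy
      refine e.toHomeomorph.injective (h ⟨x, hx, rfl⟩ ⟨y, hy, rfl⟩ ?_)
      rw [← e.map_src, ← e.map_src, hxy]
    · rintro h _ ⟨x, hx, rfl⟩ _ ⟨y, hy, rfl⟩ hxy
      rw [← e.map_src, ← e.map_src] at hxy
      rw [h hx hy (e.toHomeomorph.injective hxy)]
  have hr : Set.InjOn rng (e.toHomeomorph '' U) ↔ Set.InjOn rng U := by
    constructor
    · intro h x hx y hy hxy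
      refine e.toHomeomorph.injective (h ⟨x, hx, rfl⟩ ⟨y, hy, rfl⟩ ?_)
      rw [← e.map_rng, ← e.map_rng, hxy]
    · rintro h _ ⟨x, hx, rfl⟩ _ ⟨y, hy, rfl⟩ hxy
      rw [← e.map_rng, ← e.map_rng] at hxy
      rw [h hx hy (e.toHomeomorph.injective hxy)]
  constructor
  · rintro ⟨h1, h2, h3, h4⟩
    exact ⟨e.toHomeomorph.isCompact_image.1 h1, e.toHomeomorph.isOpen_image.1 h2, hs.1 h3,
      hr.1 h4⟩
  · rintro ⟨h1, h2, h3, h4⟩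
    exact ⟨e.toHomeomorph.isCompact_image.2 h1, e.toHomeomorph.isOpen_image.2 h2, hs.2 h3,
      hr.2 h4⟩

/-- The transport of functionals along an isomorphism. -/
def functionalEquiv : ((G → ℚ) →ₗ[ℚ] ℚ) ≃ₗ[ℚ] ((H → ℚ) →ₗ[ℚ] ℚ) :=
  (LinearEquiv.funCongrLeft ℚ ℚ e.toHomeomorph.toEquiv).dualMap

theorem functionalEquiv_ind (l : (G → ℚ) →ₗ[ℚ] ℚ) (U : Set G) :
    e.functionalEquiv l (ind (e.toHomeomorph '' U)) = l (ind U) := by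
  change l (fun g => ind (e.toHomeomorph '' U) (e.toHomeomorph g)) = _
  congr 1
  funext g
  by_cases h : g ∈ U
  · rw [ind_of_mem h, ind_of_mem (Set.mem_image_of_mem _ h)]
  · rw [ind_of_notMem h, ind_of_notMem]
    rwa [e.toHomeomorph.injective.mem_set_image]

theorem forall_bisection {p : Set H → Prop} :
    (∀ U, IsCompactOpenBisection U → p U) ↔
      ∀ U : Set G, IsCompactOpenBisection U → p (e.toHomeomorph '' U) := by
  constructor
  · exact fun h U hU => h _ (e.isCompactOpenBisection_image.2 hU)
  · intro h U hU
    have hU' : e.toHomeomorph '' (e.toHomeomorph ⁻¹' U) = U :=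
      Set.image_preimage_eq _ e.toHomeomorph.surjective
    rw [← hU']
    exact h _ (e.isCompactOpenBisection_image.1 (by rwa [hU']))

theorem mem_cocycles (l : (G → ℚ) →ₗ[ℚ] ℚ) :
    e.functionalEquiv l ∈ cocycles H ↔ l ∈ cocycles G := by
  have : e.functionalEquiv l ∈ cocycles H ↔ ∀ U : Set H, IsCompactOpenBisection U → ∀ V : Set H,
      IsCompactOpenBisection V → src '' U = rng '' V → e.functionalEquiv l (ind (mulSet U V)) =
        e.functionalEquiv l (ind U) + e.functionalEquiv l (ind V) :=
    ⟨fun h U hU V hV => h U V hU hV, fun h U V hU hV => h U hU V hV⟩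
  rw [this, e.forall_bisection]
  constructor
  · intro h U V hU hV hUV
    have h1 := h U hU _ (e.isCompactOpenBisection_image.2 hV)
      (by rw [← e.image_src, ← e.image_rng, hUV])
    rwa [← e.image_mulSet, e.functionalEquiv_ind, e.functionalEquiv_ind,
      e.functionalEquiv_ind] at h1
  · intro h U hU
    rw [e.forall_bisection]
    intro V hV hUV
    rw [← e.image_mulSet, e.functionalEquiv_ind, e.functionalEquiv_ind, e.functionalEquiv_ind]
    refine h U V hU hV ?_
    rw [← e.image_src, ← e.image_rng] at hUV
    exact Set.image_injective.2 e.toHomeomorph.injective hUV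

theorem mem_coboundaries (l : (G → ℚ) →ₗ[ℚ] ℚ) :
    e.functionalEquiv l ∈ coboundaries H ↔ l ∈ coboundaries G := by
  refine Iff.trans (e.functionalEquiv.surjective.exists) (exists_congr fun k => ?_)
  rw [e.forall_bisection]
  refine forall₂_congr fun U hU => ?_
  rw [← e.image_src, ← e.image_rng, e.functionalEquiv_ind, e.functionalEquiv_ind,
    e.functionalEquiv_ind]

theorem mem_invariants (l : (G → ℚ) →ₗ[ℚ] ℚ) :
    e.functionalEquiv l ∈ invariants H ↔ l ∈ invariants G := by
  refine (e.forall_bisection).trans (forall₂_congr fun U hU => ?_)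
  rw [← e.image_src, ← e.image_rng, e.functionalEquiv_ind, e.functionalEquiv_ind]

theorem mem_nullFunctionals (l : (G → ℚ) →ₗ[ℚ] ℚ) :
    e.functionalEquiv l ∈ nullFunctionals H ↔ l ∈ nullFunctionals G := by
  refine (e.forall_bisection).trans (forall₂_congr fun U hU => ?_)
  rw [← e.image_src, e.functionalEquiv_ind]

theorem invariantDim_eq (e : TopIso G H) : invariantDim G = invariantDim H :=
  finrank_quotient_eq e.functionalEquiv e.mem_invariants e.mem_nullFunctionals

theorem cocycleDim_eq (e : TopIso G H) : cocycleDim G = cocycleDim H :=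
  finrank_quotient_eq e.functionalEquiv e.mem_cocycles e.mem_coboundaries

end TopIso

end ArrowGroupoid

namespace Katsura

variable {N : ℕ} {A : Matrix (Fin N) (Fin N) ℤ}

/-! ### Edges -/

instance : Finite (Edge A) := by
  refine Finite.of_injective
    (β := Σ i : Fin N, Σ j : Fin N, Fin (A i j).toNat)
    (fun e => ⟨e.src, e.tgt, ⟨e.idx.toNat, by have := e.idx_nonneg; have := e.idx_lt; omega⟩⟩) ?_
  rintro ⟨i, j, n, h0, h1⟩ ⟨i', j', n', h0', h1'⟩ h
  simp only [Sigma.mk.injEq] at h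
  obtain ⟨rfl, h⟩ := h
  rw [heq_eq_eq, Sigma.mk.injEq] at h
  obtain ⟨rfl, h⟩ := h
  rw [heq_eq_eq, Fin.mk.injEq] at h
  obtain rfl : n = n' := by omega
  rfl

instance : DiscreteTopology (Edge A) := ⟨rfl⟩

/-- The edges with a given source. -/
abbrev OutEdge (A : Matrix (Fin N) (Fin N) ℤ) (v : Fin N) : Type := {e : Edge A // v = e.src}

noncomputable instance (v : Fin N) : Fintype (OutEdge A v) := Fintype.ofFinite _

/-- The edges with source `v`, enumerated by range and index. -/
def outEdgeEquiv (v : Fin N) : OutEdge A v ≃ Σ w : Fin N, Fin (A v w).toNat where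
  toFun e := ⟨e.1.tgt, ⟨e.1.idx.toNat, by
    have := e.1.idx_nonneg
    have := e.1.idx_lt
    rw [← e.2] at this
    omega⟩⟩
  invFun p := ⟨⟨v, p.1, p.2.1, by omega, by have := p.2.2; omega⟩, rfl⟩
  left_inv := by
    rintro ⟨e, rfl⟩
    exact Subtype.ext (Edge.ext rfl rfl (Int.toNat_of_nonneg e.idx_nonneg))
  right_inv := by
    rintro ⟨w, n, hn⟩
    rfl

theorem sum_outEdge (hA : ∀ i j, 0 ≤ A i j) (v : Fin N) (f : Fin N → ℚ) :
    ∑ e : OutEdge A v, f e.1.tgt = ∑ w, (A v w : ℚ) * f w := by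
  refine (Fintype.sum_equiv (outEdgeEquiv v) (fun e => f e.1.tgt) (fun p => f p.1)
    (fun e => rfl)).trans ?_
  rw [Fintype.sum_sigma]
  refine Finset.sum_congr rfl fun w _ => ?_
  change ∑ _n : Fin (A v w).toNat, f w = _
  rw [Finset.sum_const, Finset.card_univ, Fintype.card_fin, nsmul_eq_mul]
  congr 1
  exact_mod_cast Int.toNat_of_nonneg (hA v w)

variable (B : Matrix (Fin N) (Fin N) ℤ)

/-- The action of an integer on the edges with source `v`. -/
def outEdgeAct (v : Fin N) (m : ℤ) : OutEdge A v ≃ OutEdge A v where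
  toFun e := ⟨act B m e.1, e.2⟩
  invFun e := ⟨act B (-m) e.1, e.2⟩
  left_inv e := Subtype.ext (by
    change act B (-m) (act B m e.1) = e.1
    rw [← (act_coc_add B _ _ _).1, neg_add_cancel, (act_coc_zero B _).1])
  right_inv e := Subtype.ext (by
    change act B m (act B (-m) e.1) = e.1
    rw [← (act_coc_add B _ _ _).1, add_neg_cancel, (act_coc_zero B _).1])

theorem sum_coc_outEdge {B} (hA : ∀ i j, 0 ≤ A i j) (hsupp : ∀ i j, A i j = 0 → B i j = 0)
    (v : Fin N) (m : ℤ) (f : Fin N → ℚ) :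
    ∑ e : OutEdge A v, (coc B m e.1 : ℚ) * f e.1.tgt = m * ∑ w, (B v w : ℚ) * f w := by
  have h1 : ∀ e : OutEdge A v, (coc B m e.1 : ℚ) * f e.1.tgt =
      m * (B v e.1.tgt / A v e.1.tgt) * f e.1.tgt +
        ((e.1.idx : ℚ) / A v e.1.tgt * f e.1.tgt -
          ((outEdgeAct B v m e).1.idx : ℚ) / A v (outEdgeAct B v m e).1.tgt *
            f (outEdgeAct B v m e).1.tgt) := by
    rintro ⟨e, rfl⟩
    have hpos : (A e.src e.tgt : ℚ) ≠ 0 := by exact_mod_cast e.pos.ne'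
    have h2 : (coc B m e : ℚ) * A e.src e.tgt + (act B m e).idx = m * B e.src e.tgt + e.idx := by
      exact_mod_cast coc_mul_add B m e
    change _ = m * (B e.src e.tgt / A e.src e.tgt : ℚ) * f e.tgt +
      ((e.idx : ℚ) / A e.src e.tgt * f e.tgt - ((act B m e).idx : ℚ) / A e.src e.tgt * f e.tgt)
    field_simp
    linear_combination f e.tgt * h2
  rw [Finset.sum_congr rfl fun e _ => h1 e, Finset.sum_add_distrib, Finset.sum_sub_distrib,
    Equiv.sum_comp (outEdgeAct B v m)
      (fun e : OutEdge A v => (e.1.idx : ℚ) / A v e.1.tgt * f e.1.tgt), sub_self, add_zero,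
    sum_outEdge hA v fun w => m * (B v w / A v w : ℚ) * f w, Finset.mul_sum]
  refine Finset.sum_congr rfl fun w _ => ?_
  by_cases h : A v w = 0
  · simp [h, hsupp v w h]
  · have : (A v w : ℚ) ≠ 0 := by exact_mod_cast h
    field_simp

/-! ### Infinite paths and cylinders -/

namespace InfPath

/-- The infinite path `e y`. -/
def cons (e : Edge A) (y : InfPath A) (h : e.tgt = y.start) : InfPath A :=
  ⟨fun n => Nat.casesOn n e y.1, fun n => by cases n with
    | zero => exact h
    | succ n => exact y.2 n⟩

/-- The infinite path without its first `n` edges. -/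
def drop (n : ℕ) (y : InfPath A) : InfPath A := ⟨fun i => y.1 (n + i), fun i => y.2 (n + i)⟩

/-- The two paths have the same first `n` edges. -/
def Agree (n : ℕ) (x y : InfPath A) : Prop := ∀ i < n, x.1 i = y.1 i

theorem Agree.symm {n : ℕ} {x y : InfPath A} (h : Agree n x y) : Agree n y x :=
  fun i hi => (h i hi).symm

theorem Agree.mono {n k : ℕ} {x y : InfPath A} (h : Agree n x y) (hk : k ≤ n) : Agree k x y :=
  fun i hi => h i (hi.trans_le hk)

theorem isOpen_iff {U : Set (InfPath A)} :
    IsOpen U ↔ ∀ x ∈ U, ∃ n, ∀ z, Agree n z x → z ∈ U := by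
  have hind : Topology.IsInducing (fun x : InfPath A => x.1) := ⟨rfl⟩
  have hbas := (PiNat.isTopologicalBasis_cylinders fun _ => Edge A).isInducing hind
  rw [hbas.isOpen_iff]
  refine forall₂_congr fun x hx => ?_
  constructor
  · rintro ⟨_, ⟨_, ⟨y, n, rfl⟩, rfl⟩, h1, h2⟩
    exact ⟨n, fun z hz => h2 fun i hi => (hz i hi).trans (h1 i hi)⟩
  · rintro ⟨n, hn⟩
    exact ⟨_, ⟨_, ⟨x.1, n, rfl⟩, rfl⟩, fun i _ => rfl, fun z hz => hn z hz⟩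

instance : CompactSpace (InfPath A) := by
  have hcl : IsClosed {x : ℕ → Edge A | ∀ n, (x n).tgt = (x (n + 1)).src} := by
    rw [Set.ofPred_forall]
    refine isClosed_iInter fun n => isClosed_eq ?_ ?_
    · exact (continuous_of_discreteTopology (f := fun e : Edge A => e.tgt)).comp
        (continuous_apply n)
    · exact (continuous_of_discreteTopology (f := fun e : Edge A => e.src)).comp
        (continuous_apply (n + 1))
  exact isCompact_iff_compactSpace.1 hcl.isCompact

end InfPath

theorem prepend_lt {X : Type*} (l : List X) (y y' : ℕ → X) {i : ℕ} (hi : i < l.length) :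
    prepend l y i = prepend l y' i := by
  induction l generalizing i with
  | nil => simp at hi
  | cons e l ih =>
    cases i with
    | zero => rfl
    | succ i => exact ih (by simpa using hi)

theorem prepend_length_add {X : Type*} (l : List X) (y : ℕ → X) (i : ℕ) :
    prepend l y (l.length + i) = y i := by
  induction l with
  | nil => exact congrArg y (Nat.zero_add i)
  | cons e l ih =>
    rw [List.length_cons, Nat.add_right_comm]
    exact ih

namespace FinPath

open InfPath

theorem agree_of_mem_cylinder {β : FinPath A} {x z : InfPath A} (hx : x ∈ β.cylinder)
    (hz : z ∈ β.cylinder) : Agree β.edges.length x z := by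
  obtain ⟨y, h, rfl⟩ := hx
  obtain ⟨y', h', rfl⟩ := hz
  exact fun i hi => prepend_lt _ _ _ hi

theorem mem_cylinder_of_agree {β : FinPath A} {x z : InfPath A} (hx : x ∈ β.cylinder)
    (h : Agree (β.edges.length + 1) z x) : z ∈ β.cylinder := by
  obtain ⟨y, hy, rfl⟩ := hx
  refine ⟨z.drop β.edges.length, ?_, Subtype.ext (funext fun i => ?_)⟩
  · change _ = (z.1 (β.edges.length + 0)).src
    rw [h _ (by omega), hy]
    change _ = (prepend β.edges y.1 (β.edges.length + 0)).src
    rw [prepend_length_add]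
    rfl
  · change _ = prepend β.edges (z.drop β.edges.length).1 i
    by_cases hi : i < β.edges.length
    · rw [h i (by omega)]
      exact prepend_lt _ _ _ hi
    · obtain ⟨k, rfl⟩ := Nat.exists_eq_add_of_le (not_lt.1 hi)
      rw [prepend_length_add]
      rfl

theorem isOpen_cylinder (β : FinPath A) : IsOpen β.cylinder :=
  InfPath.isOpen_iff.2 fun _ hx => ⟨_, fun _ hz => mem_cylinder_of_agree hx hz⟩

theorem isCompact_cylinder (β : FinPath A) : IsCompact β.cylinder := by
  refine IsClosed.isCompact ⟨InfPath.isOpen_iff.2 fun x hx => ⟨β.edges.length + 1, fun z hz h => ?_⟩⟩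
  exact hx (mem_cylinder_of_agree h hz.symm)

theorem cylinder_snoc_subset (β : FinPath A) (e : Edge A) (h : β.tgt = e.src) :
    (β.snoc e h).cylinder ⊆ β.cylinder := by
  rintro _ ⟨y, hy, rfl⟩
  refine ⟨y.cons e hy, h, ?_⟩
  exact (append_snoc β (y.cons e hy) h)

end FinPath

/-! ### Quadruples with the same finite data -/

namespace Quad

variable {B}

/-- The quadruples `(α, m, β; x)` and `(α, m, β; x')`. -/
def SameTriple (p q : Quad A) : Prop := p.α = q.α ∧ p.m = q.m ∧ p.β = q.β

theorem SameTriple.exists_step {p q : Quad A} (h : SameTriple p (q.step B)) :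
    ∃ p', SameTriple p' q ∧ p'.step B = p := by
  obtain ⟨h1, h2, h3⟩ := h
  have h4 : (q.y.1 0).tgt = p.y.start := by rw [← p.hβ, h3]; rfl
  exact ⟨⟨q.α, q.m, q.β, p.y.cons (q.y.1 0) h4, q.hα, q.hβ⟩, ⟨rfl, rfl, rfl⟩,
    ext_of h1.symm h2.symm h3.symm rfl⟩

theorem SameTriple.exists_iterate {p q : Quad A} {n : ℕ}
    (h : SameTriple p ((step B)^[n] q)) : ∃ p', SameTriple p' q ∧ (step B)^[n] p' = p := by
  induction n generalizing p with
  | zero => exact ⟨p, h, rfl⟩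
  | succ n ih =>
    rw [Function.iterate_succ_apply'] at h
    obtain ⟨p', h1, rfl⟩ := h.exists_step
    obtain ⟨p'', h2, rfl⟩ := ih h1
    exact ⟨p'', h2, Function.iterate_succ_apply' _ _ _⟩

theorem SameTriple.iterate {p q : Quad A} (h : SameTriple p q) {n : ℕ}
    (hy : InfPath.Agree n p.y q.y) : SameTriple ((step B)^[n] p) ((step B)^[n] q) := by
  induction n generalizing p q with
  | zero => exact h
  | succ n ih =>
    rw [Function.iterate_succ_apply, Function.iterate_succ_apply]
    obtain ⟨h1, h2, h3⟩ := h
    have h0 : p.y.1 0 = q.y.1 0 := hy 0 (Nat.succ_pos n)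
    refine ih ⟨?_, ?_, ?_⟩ fun i hi => hy (i + 1) (Nat.succ_lt_succ hi)
    · refine FinPath.ext_of (congrArg FinPath.src h1 :) ?_
      change p.α.edges ++ [act B p.m (p.y.1 0)] = q.α.edges ++ [act B q.m (q.y.1 0)]
      rw [h1, h2, h0]
    · change coc B p.m (p.y.1 0) = coc B q.m (q.y.1 0)
      rw [h2, h0]
    · refine FinPath.ext_of (congrArg FinPath.src h3 :) ?_
      change p.β.edges ++ [p.y.1 0] = q.β.edges ++ [q.y.1 0]
      rw [h3, h0]

theorem pt_mem_cylinder (q : Quad A) : q.pt ∈ q.β.cylinder := ⟨q.y, q.hβ, rfl⟩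

theorem im_mem_cylinder (q : Quad A) : q.im B ∈ q.α.cylinder := ⟨q.y.act B q.m, q.hα, rfl⟩

theorem pt_iterate (n : ℕ) (q : Quad A) : ((step B)^[n] q).pt = q.pt := by
  induction n generalizing q with
  | zero => rfl
  | succ n ih => rw [Function.iterate_succ_apply, ih, pt_step]

theorem im_iterate (n : ℕ) (q : Quad A) : ((step B)^[n] q).im B = q.im B := by
  induction n generalizing q with
  | zero => rfl
  | succ n ih => rw [Function.iterate_succ_apply, ih, im_step]

theorem step_injective (hpf : PseudoFree A B) : Function.Injective (step B : Quad A → Quad A) := by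
  intro p q h
  have h1 : p.β.snoc (p.y.1 0) p.hβ = q.β.snoc (q.y.1 0) q.hβ := congrArg Quad.β h
  have h2 : p.α.snoc (act B p.m (p.y.1 0)) p.hα = q.α.snoc (act B q.m (q.y.1 0)) q.hα :=
    congrArg Quad.α h
  have h3 : coc B p.m (p.y.1 0) = coc B q.m (q.y.1 0) := congrArg Quad.m h
  obtain ⟨h4, h5⟩ := FinPath.snoc_inj h1
  obtain ⟨h6, h7⟩ := FinPath.snoc_inj h2
  have h8 : p.y.shift = q.y.shift := congrArg Quad.y h
  refine ext_of h6 ?_ h4 (InfPath.ext_of h5 h8)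
  have h9 := act_coc_add B (p.m - q.m) q.m (q.y.1 0)
  rw [sub_add_cancel, ← h5, h3, h7, ← h5] at h9
  have := hpf _ _ h9.1.symm (by linarith [h9.2])
  linarith

end Quad

namespace KEP

variable {B}

theorem exists_iterate_eq {p q : Quad A} (h : (mk p : KEP A B) = mk q) :
    ∃ a b, (Quad.step B)^[a] p = (Quad.step B)^[b] q := by
  induction Quot.eqvGen_exact h with
  | rel p q e => exact ⟨1, 0, e.symm⟩
  | refl p => exact ⟨0, 0, rfl⟩
  | symm p q _ ih =>
    obtain ⟨a, b, e⟩ := ih h.symm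
    exact ⟨b, a, e.symm⟩
  | trans p q t e e' ih ih' =>
    obtain ⟨a, b, h1⟩ := ih (Quot.eqvGen_sound e)
    obtain ⟨c, d, h2⟩ := ih' (Quot.eqvGen_sound e')
    refine ⟨c + a, b + d, ?_⟩
    rw [Function.iterate_add_apply, h1, ← Function.iterate_add_apply, add_comm c b,
      Function.iterate_add_apply, h2, ← Function.iterate_add_apply]

theorem mk_injective (hpf : PseudoFree A B) {p q : Quad A}
    (hl : p.β.edges.length = q.β.edges.length) (h : (mk p : KEP A B) = mk q) : p = q := by
  obtain ⟨a, b, h⟩ := exists_iterate_eq h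
  have h1 := congrArg (fun q : Quad A => q.β.edges.length) h
  simp only [(length_iterate _ _).2] at h1
  obtain rfl : a = b := by omega
  exact (Quad.step_injective hpf).iterate a h

theorem mem_of_sameTriple_iterate {O : Set (KEP A B)} {q : Quad A} {n k : ℕ} (hk : n ≤ k)
    (h : ∀ p, Quad.SameTriple p ((Quad.step B)^[n] q) → mk p ∈ O) (p : Quad A)
    (hp : Quad.SameTriple p ((Quad.step B)^[k] q)) : mk p ∈ O := by
  obtain ⟨i, rfl⟩ := Nat.exists_eq_add_of_le hk
  rw [add_comm, Function.iterate_add_apply] at hp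
  obtain ⟨p', h1, rfl⟩ := hp.exists_iterate
  rw [mk_iterate]
  exact h p' h1

/-- Every neighbourhood of an arrow contains all arrows with the same finite data, after
sufficiently many refinements. -/
theorem exists_sameTriple_of_isOpen {O : Set (KEP A B)} (hO : IsOpen O) {q : Quad A}
    (hq : mk q ∈ O) : ∃ n, ∀ p, Quad.SameTriple p ((Quad.step B)^[n] q) → mk p ∈ O := by
  induction hO with
  | basic O hO =>
    obtain ⟨α, m, β, U, -, -, hU, -, rfl⟩ := hO
    obtain ⟨q₁, rfl, rfl, rfl, h2, h3⟩ := hq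
    obtain ⟨a, b, hab⟩ := exists_iterate_eq h3
    obtain ⟨k, hk⟩ := InfPath.isOpen_iff.1 hU _ h2
    refine ⟨k + a, fun p hp => ?_⟩
    rw [Function.iterate_add_apply, hab, ← Function.iterate_add_apply] at hp
    have h4 : InfPath.Agree k p.pt q₁.pt := by
      rw [← Quad.pt_iterate (B := B) (k + b) q₁]
      have h5 := Quad.pt_mem_cylinder p
      rw [hp.2.2] at h5
      refine (FinPath.agree_of_mem_cylinder h5 (Quad.pt_mem_cylinder _)).mono ?_
      rw [(length_iterate _ _).2]
      omega
    obtain ⟨p', h6, rfl⟩ := hp.exists_iterate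
    rw [Quad.pt_iterate] at h4
    exact ⟨p', h6.1, h6.2.1, h6.2.2, hk _ h4, mk_iterate _ _⟩
  | univ => exact ⟨0, fun _ _ => trivial⟩
  | inter O O' _ _ ih ih' =>
    obtain ⟨n, hn⟩ := ih hq.1
    obtain ⟨n', hn'⟩ := ih' hq.2
    exact ⟨max n n', fun p hp => ⟨mem_of_sameTriple_iterate (le_max_left _ _) hn p hp,
      mem_of_sameTriple_iterate (le_max_right _ _) hn' p hp⟩⟩
  | sUnion 𝒪 _ ih =>
    obtain ⟨O, hO, hqO⟩ := hq
    obtain ⟨n, hn⟩ := ih O hO hqO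
    exact ⟨n, fun p hp => ⟨O, hO, hn p hp⟩⟩

theorem continuous_unit : Continuous (unit : InfPath A → KEP A B) := by
  refine ⟨fun O hO => InfPath.isOpen_iff.2 fun x hx => ?_⟩
  obtain ⟨n, hn⟩ := exists_sameTriple_of_isOpen hO hx
  refine ⟨n + 1, fun z hz => ?_⟩
  have hs : z.start = x.start := congrArg Edge.src (hz 0 (Nat.succ_pos n))
  change mk _ ∈ O
  rw [← mk_iterate n]
  have hv : (FinPath.vertex z.start : FinPath A) = FinPath.vertex x.start :=
    congrArg FinPath.vertex hs
  exact hn _ (Quad.SameTriple.iterate (p := ⟨_, _, _, _, _, _⟩) (q := ⟨_, _, _, _, _, _⟩)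
    ⟨hv, rfl, hv⟩ (hz.mono (Nat.le_succ n)))

end KEP

end Katsura

namespace Katsura

open ArrowGroupoid

variable {N : ℕ} {A B : Matrix (Fin N) (Fin N) ℤ}

/-- The existence of an infinite path from each vertex. -/
theorem exists_infPath (hA : ∀ i j, 0 ≤ A i j) (hrow : ∀ i, ∃ j, A i j ≠ 0) (v : Fin N) :
    ∃ y : InfPath A, v = y.start := by
  have h : ∀ i, ∃ e : Edge A, e.src = i := fun i => by
    obtain ⟨j, hj⟩ := hrow i
    exact ⟨⟨i, j, 0, le_rfl, lt_of_le_of_ne (hA i j) hj.symm⟩, rfl⟩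
  choose γ hγ using h
  refine ⟨⟨fun n => γ ((fun i => (γ i).tgt)^[n] v), fun n => ?_⟩, (hγ v).symm⟩
  rw [hγ, Function.iterate_succ_apply']

/-- An infinite path as a unit of the groupoid. -/
def unitPt (x : InfPath A) : UnitSpace (KEP A B) := ⟨KEP.unit x, rfl⟩

/-- All infinite paths with initial segment `α` are in `S`. -/
def InSet (S : Set (UnitSpace (KEP A B))) (α : FinPath A) : Prop :=
  ∀ x ∈ α.cylinder, unitPt x ∈ S

theorem InSet.snoc {S : Set (UnitSpace (KEP A B))} {α : FinPath A} (h : InSet S α) (e : Edge A)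
    (he : α.tgt = e.src) : InSet S (α.snoc e he) :=
  fun x hx => h x (α.cylinder_snoc_subset e he hx)

theorem isOpen_unitPt_preimage {S : Set (UnitSpace (KEP A B))} (hS : IsOpen S) :
    IsOpen {x : InfPath A | (unitPt x : UnitSpace (KEP A B)) ∈ S} :=
  hS.preimage (Continuous.subtype_mk KEP.continuous_unit _)

/-- Long initial segments of a path in an open set `S` have their cylinders in `S`. -/
theorem exists_inSet {S : Set (UnitSpace (KEP A B))} (hS : IsOpen S) {x : InfPath A}
    (hx : unitPt x ∈ S) :
    ∃ n, ∀ α : FinPath A, n ≤ α.edges.length → x ∈ α.cylinder → InSet S α := by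
  obtain ⟨n, hn⟩ := InfPath.isOpen_iff.1 (isOpen_unitPt_preimage hS) x hx
  exact ⟨n, fun α hα hxα z hz => hn z ((FinPath.agree_of_mem_cylinder hz hxα).mono hα)⟩

/-- The triples `(α, m, β)` with `r(α) = r(β)` and `Z(α), Z(β) ⊆ S`. -/
structure Cell (S : Set (UnitSpace (KEP A B))) where
  α : FinPath A
  m : ℤ
  β : FinPath A
  tgt_eq : α.tgt = β.tgt
  hα : InSet S α
  hβ : InSet S β

namespace Cell

variable {S : Set (UnitSpace (KEP A B))}

theorem ext_of {t t' : Cell S} (h1 : t.α = t'.α) (h2 : t.m = t'.m) (h3 : t.β = t'.β) :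
    t = t' := by
  cases t
  cases t'
  cases h1
  cases h2
  cases h3
  rfl

/-- The triple `(α κ_m(e), φ(m, e), β e)`. -/
def child (t : Cell S) (e : OutEdge A t.β.tgt) : Cell S where
  α := t.α.snoc (act B t.m e.1) (t.tgt_eq.trans e.2)
  m := coc B t.m e.1
  β := t.β.snoc e.1 e.2
  tgt_eq := rfl
  hα := t.hα.snoc _ _
  hβ := t.hβ.snoc _ _

/-- The quadruple `(α, m, β; β y)`. -/
def quad (t : Cell S) (y : InfPath A) (h : t.β.tgt = y.start) : Quad A :=
  ⟨t.α, t.m, t.β, y, t.tgt_eq.trans h, h⟩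

/-- The arrow `[α, m, β; β y]`. -/
def arrow (t : Cell S) (y : InfPath A) (h : t.β.tgt = y.start) : Restriction S :=
  ⟨KEP.mk (t.quad y h), t.hβ _ (t.quad y h).pt_mem_cylinder, t.hα _ (t.quad y h).im_mem_cylinder⟩

/-- The set of all arrows `[α, m, β; x]`. -/
def arrows (t : Cell S) : Set (Restriction S) :=
  {g | ∃ (y : InfPath A) (h : t.β.tgt = y.start), g = t.arrow y h}

theorem mem_arrows_of {t : Cell S} {g : Restriction S} {q : Quad A} (hg : g.1 = KEP.mk q)
    (h1 : q.α = t.α) (h2 : q.m = t.m) (h3 : q.β = t.β) : g ∈ t.arrows := by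
  refine ⟨q.y, h3 ▸ q.hβ, Subtype.ext (hg.trans ?_)⟩
  exact congrArg KEP.mk (Quad.ext_of h1 h2 h3 rfl)

theorem arrows_child_subset (t : Cell S) (e : OutEdge A t.β.tgt) :
    (t.child e).arrows ⊆ t.arrows := by
  rintro _ ⟨y, h, rfl⟩
  exact ⟨y.cons e.1 h, e.2, Subtype.ext (KEP.mk_step (t.quad (y.cons e.1 h) e.2))⟩

theorem arrow_mem_child (t : Cell S) (y : InfPath A) (h : t.β.tgt = y.start) :
    t.arrow y h ∈ (t.child ⟨y.1 0, h⟩).arrows :=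
  ⟨y.shift, (InfPath.start_shift y).symm, Subtype.ext (KEP.mk_step (t.quad y h)).symm⟩

theorem eq_of_mem (hpf : PseudoFree A B) {t t' : Cell S}
    (hl : t.β.edges.length = t'.β.edges.length) {g : Restriction S} (h : g ∈ t.arrows)
    (h' : g ∈ t'.arrows) : t = t' := by
  obtain ⟨y, hy, rfl⟩ := h
  obtain ⟨y', hy', e⟩ := h'
  have h1 : t.quad y hy = t'.quad y' hy' := KEP.mk_injective hpf hl (congrArg Subtype.val e)
  exact ext_of (congrArg Quad.α h1) (congrArg Quad.m h1) (congrArg Quad.β h1)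

theorem child_injective (t : Cell S) : Function.Injective t.child := by
  intro e e' h
  exact Subtype.ext (FinPath.snoc_inj (hα := e.2) (hβ := e'.2) (congrArg Cell.β h)).2

variable (S) in
/-- The tree of basic open sets of arrows. -/
noncomputable def tree (hA : ∀ i j, 0 ≤ A i j) (hrow : ∀ i, ∃ j, A i j ≠ 0)
    (hpf : PseudoFree A B) : SetTree (Restriction S) (Cell S) where
  cell := arrows
  level t := t.β.edges.length
  Index t := OutEdge A t.β.tgt
  fintype _ := inferInstance
  child := child
  cell_nonempty t := by
    obtain ⟨y, hy⟩ := exists_infPath hA hrow t.β.tgt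
    exact ⟨_, y, hy, rfl⟩
  cell_child := arrows_child_subset
  exists_child t x hx := by
    obtain ⟨y, hy, rfl⟩ := hx
    exact ⟨_, t.arrow_mem_child y hy⟩
  level_child t e := by simp [child, FinPath.snoc]
  child_injective := child_injective
  eq_of_mem t t' hl g h h' := eq_of_mem hpf hl h h'

theorem isOpen_arrows (t : Cell S) : IsOpen t.arrows := by
  have h : IsOpen (KEP.basicSet t.α t.m t.β t.β.cylinder : Set (KEP A B)) :=
    TopologicalSpace.isOpen_generateFrom_of_mem ⟨_, _, _, _, t.tgt_eq, t.β.isCompact_cylinder,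
      t.β.isOpen_cylinder, subset_rfl, rfl⟩
  have e : t.arrows = (fun g : Restriction S => g.1) ⁻¹'
      (KEP.basicSet t.α t.m t.β t.β.cylinder : Set (KEP A B)) := by
    ext g
    constructor
    · rintro ⟨y, hy, rfl⟩
      exact ⟨t.quad y hy, rfl, rfl, rfl, (t.quad y hy).pt_mem_cylinder, rfl⟩
    · rintro ⟨q, h1, h2, h3, -, h5⟩
      exact mem_arrows_of h5 h1 h2 h3
  rw [e]
  exact h.preimage continuous_subtype_val

theorem isCompact_arrows (t : Cell S) : IsCompact t.arrows := by
  have hK : IsCompact {y : InfPath A | t.β.tgt = y.start} := by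
    have : {y : InfPath A | t.β.tgt = y.start} = (FinPath.vertex t.β.tgt : FinPath A).cylinder := by
      ext y
      constructor
      · exact fun h => ⟨y, h, rfl⟩
      · rintro ⟨z, h, rfl⟩
        exact h
    rw [this]
    exact FinPath.isCompact_cylinder _
  have hcont : Continuous fun y : {y : InfPath A // t.β.tgt = y.start} =>
      (KEP.mk (t.quad y.1 y.2) : KEP A B) := by
    refine ⟨fun O hO => ?_⟩
    rw [isOpen_iff_forall_mem_open]
    intro y hy
    obtain ⟨n, hn⟩ := KEP.exists_sameTriple_of_isOpen hO hy
    refine ⟨Subtype.val ⁻¹' {z | InfPath.Agree n z y.1}, fun z hz => ?_, ?_, fun i _ => rfl⟩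
    · change KEP.mk _ ∈ O
      rw [← KEP.mk_iterate n]
      exact hn _ (Quad.SameTriple.iterate (p := t.quad z.1 z.2) (q := t.quad y.1 y.2)
        ⟨rfl, rfl, rfl⟩ hz)
    · refine IsOpen.preimage continuous_subtype_val (InfPath.isOpen_iff.2 fun x hx => ⟨n, ?_⟩)
      exact fun z hz i hi => (hz i hi).trans (hx i hi)
  have hcont' : Continuous fun y : {y : InfPath A // t.β.tgt = y.start} => t.arrow y.1 y.2 :=
    Continuous.subtype_mk hcont _
  have : CompactSpace {y : InfPath A // t.β.tgt = y.start} := isCompact_iff_compactSpace.1 hK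
  have e : t.arrows = Set.range fun y : {y : InfPath A // t.β.tgt = y.start} => t.arrow y.1 y.2 := by
    ext g
    constructor
    · rintro ⟨y, hy, rfl⟩
      exact ⟨⟨y, hy⟩, rfl⟩
    · rintro ⟨y, rfl⟩
      exact ⟨y.1, y.2, rfl⟩
  rw [e]
  exact isCompact_range hcont'

theorem isCompactOpenBisection_arrows (t : Cell S) : IsCompactOpenBisection t.arrows := by
  refine ⟨t.isCompact_arrows, t.isOpen_arrows, ?_, ?_⟩
  · rintro _ ⟨y, hy, rfl⟩ _ ⟨y', hy', rfl⟩ h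
    have h1 : (t.quad y hy).pt = (t.quad y' hy').pt := KEP.unit_inj (congrArg Subtype.val h)
    obtain rfl := (FinPath.append_inj rfl h1).2
    rfl
  · rintro _ ⟨y, hy, rfl⟩ _ ⟨y', hy', rfl⟩ h
    have h1 : (t.quad y hy).im B = (t.quad y' hy').im B :=
      KEP.unit_inj (congrArg Subtype.val h)
    have h2 : y.act B t.m = y'.act B t.m := (FinPath.append_inj rfl h1).2
    have h3 := congrArg (InfPath.act B (-t.m)) h2
    rw [← InfPath.act_add, ← InfPath.act_add, neg_add_cancel, InfPath.act_zero,
      InfPath.act_zero] at h3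
    subst h3
    rfl

/-- The triple `(β, 0, β)`. -/
def srcCell (t : Cell S) : Cell S := ⟨t.β, 0, t.β, rfl, t.hβ, t.hβ⟩

/-- The triple `(α, 0, α)`. -/
def rngCell (t : Cell S) : Cell S := ⟨t.α, 0, t.α, rfl, t.hα, t.hα⟩

theorem src_arrow (t : Cell S) (y : InfPath A) (h : t.β.tgt = y.start) :
    src (t.arrow y h) = t.srcCell.arrow y h :=
  Subtype.ext (KEP.mk_eq_unit t.β y h).symm

theorem rng_arrow (t : Cell S) (y : InfPath A) (h : t.β.tgt = y.start) :
    rng (t.arrow y h) = t.rngCell.arrow (y.act B t.m) (t.tgt_eq.trans h) :=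
  Subtype.ext (KEP.mk_eq_unit t.α (y.act B t.m) (t.tgt_eq.trans h)).symm

theorem act_act_neg (m : ℤ) (y : InfPath A) : (y.act B (-m)).act B m = y := by
  rw [← InfPath.act_add, add_neg_cancel, InfPath.act_zero]

theorem image_src_arrows (t : Cell S) : src '' t.arrows = t.srcCell.arrows := by
  ext g
  constructor
  · rintro ⟨_, ⟨y, h, rfl⟩, rfl⟩
    exact ⟨y, h, t.src_arrow y h⟩
  · rintro ⟨y, h, rfl⟩
    exact ⟨_, ⟨y, h, rfl⟩, t.src_arrow y h⟩

theorem image_rng_arrows (t : Cell S) : rng '' t.arrows = t.rngCell.arrows := by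
  ext g
  constructor
  · rintro ⟨_, ⟨y, h, rfl⟩, rfl⟩
    exact ⟨_, _, t.rng_arrow y h⟩
  · rintro ⟨y, h, rfl⟩
    have h' : t.β.tgt = (y.act B (-t.m)).start := t.tgt_eq.symm.trans h
    refine ⟨_, ⟨y.act B (-t.m), h', rfl⟩, ?_⟩
    rw [rng_arrow]
    congr 1
    exact act_act_neg t.m y

/-- The product `(α, m, β) (β, m', γ) = (α, m + m', γ)`. -/
def comp (t t' : Cell S) (h : t.β = t'.α) : Cell S :=
  ⟨t.α, t.m + t'.m, t'.β, by rw [t.tgt_eq, h, t'.tgt_eq], t.hα, t'.hβ⟩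

theorem matched_quad {t t' : Cell S} (h : t.β = t'.α) (y : InfPath A) (hy : t'.β.tgt = y.start)
    (hy' : t.β.tgt = (y.act B t'.m).start) :
    Quad.Matched B (t.quad (y.act B t'.m) hy') (t'.quad y hy) := ⟨h, rfl⟩

theorem tgt_eq_start {t t' : Cell S} (h : t.β = t'.α) {y : InfPath A} (hy : t'.β.tgt = y.start) :
    t.β.tgt = (y.act B t'.m).start := by
  rw [h, t'.tgt_eq]
  exact hy

theorem src_arrow_eq_rng {t t' : Cell S} (h : t.β = t'.α) (y : InfPath A)
    (hy : t'.β.tgt = y.start) :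
    src (t.arrow (y.act B t'.m) (tgt_eq_start h hy)) = rng (t'.arrow y hy) := by
  rw [src_arrow, rng_arrow]
  exact Subtype.ext (congrArg KEP.mk (Quad.ext_of h rfl h rfl))

theorem mul_arrow {t t' : Cell S} (h : t.β = t'.α) (y : InfPath A) (hy : t'.β.tgt = y.start)
    (c : src (t.arrow (y.act B t'.m) (tgt_eq_start h hy)) = rng (t'.arrow y hy)) :
    mul (t.arrow (y.act B t'.m) (tgt_eq_start h hy)) (t'.arrow y hy) c =
      (t.comp t' h).arrow y hy :=
  Subtype.ext (KEP.mul_mk (matched_quad h y hy (tgt_eq_start h hy)))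

theorem mulSet_arrows {t t' : Cell S} (h : t.β = t'.α) :
    mulSet t.arrows t'.arrows = (t.comp t' h).arrows := by
  ext g
  constructor
  · rintro ⟨_, ⟨z, hz, rfl⟩, _, ⟨y, hy, rfl⟩, c, rfl⟩
    obtain rfl : z = y.act B t'.m := by
      have c' := c.trans (src_arrow_eq_rng h y hy).symm
      have h1 := t.isCompactOpenBisection_arrows.src_injOn ⟨_, _, rfl⟩ ⟨_, _, rfl⟩ c'
      have h2 : (t.quad z hz).pt = (t.quad _ (tgt_eq_start h hy)).pt :=
        congrArg KEP.s (congrArg Subtype.val h1)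
      exact (FinPath.append_inj rfl h2).2
    exact ⟨y, hy, mul_arrow h y hy c⟩
  · rintro ⟨y, hy, rfl⟩
    exact ⟨_, ⟨_, tgt_eq_start h hy, rfl⟩, _, ⟨y, hy, rfl⟩, src_arrow_eq_rng h y hy,
      (mul_arrow h y hy _).symm⟩

/-- The neighbourhoods of an arrow contain its refined basic open sets. -/
theorem exists_cell (hS : IsOpen S) {O : Set (Restriction S)} (hO : IsOpen O) {g : Restriction S}
    (hgO : g ∈ O) {q : Quad A} (hg : g.1 = KEP.mk q) :
    ∃ n, ∀ k ≥ n, ∃ t : Cell S, t.α = ((Quad.step B)^[k] q).α ∧ t.β = ((Quad.step B)^[k] q).β ∧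
      g ∈ t.arrows ∧ t.arrows ⊆ O := by
  obtain ⟨O', hO', rfl⟩ := isOpen_induced_iff.1 hO
  have hgO' : KEP.mk q ∈ O' := hg ▸ hgO
  obtain ⟨n₁, h₁⟩ := KEP.exists_sameTriple_of_isOpen hO' hgO'
  have hs : unitPt q.pt ∈ S := by
    have := g.2.1
    have e : source g.1 = unitPt q.pt := by rw [hg]; rfl
    rwa [e] at this
  have hr : unitPt (q.im B) ∈ S := by
    have := g.2.2
    have e : range g.1 = unitPt (q.im B) := by rw [hg]; rfl
    rwa [e] at this
  obtain ⟨n₂, h₂⟩ := exists_inSet hS hs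
  obtain ⟨n₃, h₃⟩ := exists_inSet hS hr
  refine ⟨n₁ + n₂ + n₃, fun k hk => ?_⟩
  set p := (Quad.step B)^[k] q with hp
  have hl := KEP.length_iterate (B := B) k q
  rw [← hp] at hl
  refine ⟨⟨p.α, p.m, p.β, p.hα.trans p.hβ.symm, h₃ _ (by omega) ?_, h₂ _ (by omega) ?_⟩, rfl, rfl,
    ?_, ?_⟩
  · rw [← Quad.im_iterate k q]
    exact p.im_mem_cylinder
  · rw [← Quad.pt_iterate (B := B) k q]
    exact p.pt_mem_cylinder
  · refine mem_arrows_of (q := p) ?_ rfl rfl rfl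
    rw [hg, hp, KEP.mk_iterate]
  · rintro _ ⟨y, hy, rfl⟩
    exact KEP.mem_of_sameTriple_iterate (by omega) h₁ _ ⟨rfl, rfl, rfl⟩

theorem exists_mem_arrows (hS : IsOpen S) {O : Set (Restriction S)} (hO : IsOpen O)
    {g : Restriction S} (hgO : g ∈ O) : ∃ t : Cell S, g ∈ t.arrows ∧ t.arrows ⊆ O := by
  obtain ⟨q, hq⟩ := Quot.exists_rep g.1
  obtain ⟨n, hn⟩ := exists_cell hS hO hgO hq.symm
  obtain ⟨t, -, -, h⟩ := hn n le_rfl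
  exact ⟨t, h⟩

/-- Composable arrows lie in basic open sets that match. -/
theorem exists_matching_cells (hS : IsOpen S) {U V : Set (Restriction S)} (hU : IsOpen U)
    (hV : IsOpen V) {g h : Restriction S} (hg : g ∈ U) (hh : h ∈ V) (c : src g = rng h) :
    ∃ t t' : Cell S, t.arrows ⊆ U ∧ h ∈ t'.arrows ∧ t'.arrows ⊆ V ∧ t.β = t'.α := by
  obtain ⟨q, hq⟩ := Quot.exists_rep g.1
  obtain ⟨p, hp⟩ := Quot.exists_rep h.1
  obtain ⟨n, hn⟩ := exists_cell hS hU hg hq.symm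
  obtain ⟨n', hn'⟩ := exists_cell hS hV hh hp.symm
  obtain ⟨t, -, h1, -, h2⟩ := hn (n + n' + p.α.edges.length) (by omega)
  obtain ⟨t', h3, -, h4, h5⟩ := hn' (n + n' + q.β.edges.length) (by omega)
  refine ⟨t, t', h2, h4, h5, ?_⟩
  rw [h1, h3]
  have e : q.pt = p.im B := by
    have e1 : KEP.s g.1 = KEP.r h.1 := KEP.unit_inj (congrArg Subtype.val c)
    rw [← hq, ← hp] at e1
    exact e1
  refine (FinPath.append_inj ?_ ((Quad.pt_iterate _ _).trans
    (e.trans (Quad.im_iterate _ _).symm))).1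
  rw [(KEP.length_iterate _ _).1, (KEP.length_iterate _ _).2]
  omega

end Cell

end Katsura

namespace Katsura

open ArrowGroupoid

variable {N : ℕ} {A B : Matrix (Fin N) (Fin N) ℤ}

namespace Cell

variable {S : Set (UnitSpace (KEP A B))}

theorem child_unit (β : FinPath A) (h : InSet S β) (e : OutEdge A β.tgt) :
    child ⟨β, 0, β, rfl, h, h⟩ e = ⟨β.snoc e.1 e.2, 0, β.snoc e.1 e.2, rfl, h.snoc _ _,
      h.snoc _ _⟩ := by
  refine ext_of ?_ (act_coc_zero B e.1).2 rfl
  exact FinPath.ext_of rfl (congrArg (fun f => β.edges ++ [f]) (act_coc_zero B e.1).1)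

/-- The compact open bisections are finite disjoint unions of basic open sets. -/
theorem exists_sum (hA : ∀ i j, 0 ≤ A i j) (hrow : ∀ i, ∃ j, A i j ≠ 0) (hpf : PseudoFree A B)
    (hS : IsOpen S) {U : Set (Restriction S)} (hU : IsCompactOpenBisection U) :
    ∃ F : Finset (Cell S), ind U = ∑ t ∈ F, ind t.arrows ∧
      ind (src '' U) = ∑ t ∈ F, ind t.srcCell.arrows ∧
      ind (rng '' U) = ∑ t ∈ F, ind t.rngCell.arrows := by
  obtain ⟨F, h1, h2, h3, -⟩ := (tree S hA hrow hpf).exists_finset_of_isCompact hU.isCompact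
    (fun _ => True) (fun _ _ _ => trivial) isOpen_arrows (fun g hg => by
      obtain ⟨t, ht⟩ := exists_mem_arrows hS hU.isOpen hg
      exact ⟨t, ht.1, ht.2, trivial⟩)
  have key : ∀ f : Restriction S → Restriction S, Set.InjOn f U →
      ind (f '' U) = ∑ t ∈ F, ind (f '' t.arrows) := by
    intro f hf
    refine ind_eq_sum F _ _ (fun t ht => Set.image_mono (h1 t ht)) ?_ ?_
    · rintro _ ⟨g, hg, rfl⟩
      obtain ⟨t, ht, hgt⟩ := h2 g hg
      exact ⟨t, ht, g, hgt, rfl⟩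
    · rintro t ht t' ht' _ ⟨g, hg, rfl⟩ ⟨g', hg', e⟩
      obtain rfl := hf (h1 t' ht' hg') (h1 t ht hg) e
      exact h3 t ht t' ht' _ hg hg'
  refine ⟨F, ind_eq_sum F _ _ h1 h2 h3, ?_, ?_⟩
  · rw [key src hU.src_injOn]
    exact Finset.sum_congr rfl fun t _ => by rw [image_src_arrows]
  · rw [key rng hU.rng_injOn]
    exact Finset.sum_congr rfl fun t _ => by rw [image_rng_arrows]

theorem mem_coboundaries_of (hA : ∀ i j, 0 ≤ A i j) (hrow : ∀ i, ∃ j, A i j ≠ 0)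
    (hpf : PseudoFree A B) (hS : IsOpen S) {l k : (Restriction S → ℚ) →ₗ[ℚ] ℚ}
    (h : ∀ t : Cell S, l (ind t.arrows) = k (ind t.srcCell.arrows) - k (ind t.rngCell.arrows)) :
    l ∈ coboundaries (Restriction S) := by
  refine ⟨k, fun U hU => ?_⟩
  obtain ⟨F, h1, h2, h3⟩ := exists_sum hA hrow hpf hS hU
  rw [h1, h2, h3, map_sum, map_sum, map_sum, ← Finset.sum_sub_distrib]
  exact Finset.sum_congr rfl fun t _ => h t

theorem mem_invariants_of (hA : ∀ i j, 0 ≤ A i j) (hrow : ∀ i, ∃ j, A i j ≠ 0)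
    (hpf : PseudoFree A B) (hS : IsOpen S) {l : (Restriction S → ℚ) →ₗ[ℚ] ℚ}
    (h : ∀ t : Cell S, l (ind t.srcCell.arrows) = l (ind t.rngCell.arrows)) :
    l ∈ invariants (Restriction S) := by
  intro U hU
  obtain ⟨F, h1, h2, h3⟩ := exists_sum hA hrow hpf hS hU
  rw [h2, h3, map_sum, map_sum]
  exact Finset.sum_congr rfl fun t _ => h t

theorem mem_nullFunctionals_of (hA : ∀ i j, 0 ≤ A i j) (hrow : ∀ i, ∃ j, A i j ≠ 0)
    (hpf : PseudoFree A B) (hS : IsOpen S) {l : (Restriction S → ℚ) →ₗ[ℚ] ℚ}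
    (h : ∀ t : Cell S, l (ind t.srcCell.arrows) = 0) :
    l ∈ nullFunctionals (Restriction S) := by
  intro U hU
  obtain ⟨F, h1, h2, h3⟩ := exists_sum hA hrow hpf hS hU
  rw [h2, map_sum]
  exact Finset.sum_eq_zero fun t _ => h t

theorem mem_cocycles_of (hA : ∀ i j, 0 ≤ A i j) (hrow : ∀ i, ∃ j, A i j ≠ 0)
    (hpf : PseudoFree A B) (hS : IsOpen S) {l : (Restriction S → ℚ) →ₗ[ℚ] ℚ}
    (h : ∀ (t t' : Cell S) (e : t.β = t'.α),
      l (ind (t.comp t' e).arrows) = l (ind t.arrows) + l (ind t'.arrows)) :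
    l ∈ cocycles (Restriction S) := by
  intro U V hU hV hUV
  obtain ⟨F, h1, h2, h3, h4⟩ := (tree S hA hrow hpf).exists_finset_of_isCompact hV.isCompact
    (fun t' => ∃ t : Cell S, t.arrows ⊆ U ∧ t.β = t'.α)
    (fun t' e ⟨t, ht, htt'⟩ => ⟨t.child ⟨act B t'.m e.1, by rw [htt', t'.tgt_eq]; exact e.2⟩,
      (t.arrows_child_subset _).trans ht, FinPath.ext_of (congrArg FinPath.src htt' :)
        (congrArg (fun γ : FinPath A => γ.edges ++ [act B t'.m e.1]) htt')⟩)
    isOpen_arrows (fun g hg => by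
      obtain ⟨u, hu, c⟩ : rng g ∈ src '' U := hUV ▸ ⟨g, hg, rfl⟩
      obtain ⟨t, t', h1, h2, h3, h4⟩ := exists_matching_cells hS hU.isOpen hV.isOpen hu hg c
      exact ⟨t', h2, h3, t, h1, h4⟩)
  choose! τ hτ using h4
  have hsr : ∀ t ∈ F, src '' (τ t).arrows = rng '' t.arrows := by
    intro t ht
    rw [image_src_arrows, image_rng_arrows]
    exact congrArg arrows (ext_of (hτ t ht).2 rfl (hτ t ht).2)
  have hV' : ind V = ∑ t ∈ F, ind t.arrows := ind_eq_sum F _ _ h1 h2 h3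
  have hmem : ∀ t ∈ F, ∀ v ∈ t.arrows, ∀ u ∈ U, src u = rng v → u ∈ (τ t).arrows := by
    intro t ht v hv u hu c
    obtain ⟨u', hu', c'⟩ : rng v ∈ src '' (τ t).arrows := hsr t ht ▸ ⟨v, hv, rfl⟩
    rwa [hU.src_injOn hu ((hτ t ht).1 hu') (c.trans c'.symm)]
  have hU' : ind U = ∑ t ∈ F, ind (τ t).arrows := by
    refine ind_eq_sum F _ _ (fun t ht => (hτ t ht).1) (fun u hu => ?_) ?_
    · obtain ⟨v, hv, c⟩ : src u ∈ rng '' V := hUV ▸ ⟨u, hu, rfl⟩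
      obtain ⟨t, ht, hvt⟩ := h2 v hv
      exact ⟨t, ht, hmem t ht v hvt u hu c.symm⟩
    · intro t ht t' ht' u hu hu'
      obtain ⟨v, hv, c⟩ : src u ∈ rng '' t.arrows := hsr t ht ▸ ⟨u, hu, rfl⟩
      obtain ⟨v', hv', c'⟩ : src u ∈ rng '' t'.arrows := hsr t' ht' ▸ ⟨u, hu', rfl⟩
      obtain rfl := hV.rng_injOn (h1 t ht hv) (h1 t' ht' hv') (c.trans c'.symm)
      exact h3 t ht t' ht' _ hv hv'
  have hUV' : ind (mulSet U V) = ∑ t ∈ F, ind (mulSet (τ t).arrows t.arrows) := by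
    refine ind_eq_sum F _ _ ?_ ?_ ?_
    · rintro t ht _ ⟨u, hu, v, hv, c, rfl⟩
      exact ⟨u, (hτ t ht).1 hu, v, h1 t ht hv, c, rfl⟩
    · rintro _ ⟨u, hu, v, hv, c, rfl⟩
      obtain ⟨t, ht, hvt⟩ := h2 v hv
      exact ⟨t, ht, u, hmem t ht v hvt u hu c, v, hvt, c, rfl⟩
    · rintro t ht t' ht' _ ⟨u, hu, v, hv, c, rfl⟩ ⟨u', hu', v', hv', c', e⟩
      have hs := congrArg src e
      rw [src_mul, src_mul] at hs
      obtain rfl := hV.src_injOn (h1 t ht hv) (h1 t' ht' hv') hs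
      exact h3 t ht t' ht' _ hv hv'
  rw [hUV', hU', hV', map_sum, map_sum, map_sum, ← Finset.sum_add_distrib]
  refine Finset.sum_congr rfl fun t ht => ?_
  rw [mulSet_arrows (hτ t ht).2]
  exact h _ _ _

theorem comp_of_mem_cocycles {l : (Restriction S → ℚ) →ₗ[ℚ] ℚ}
    (hl : l ∈ cocycles (Restriction S)) (t t' : Cell S) (e : t.β = t'.α) :
    l (ind (t.comp t' e).arrows) = l (ind t.arrows) + l (ind t'.arrows) := by
  rw [← mulSet_arrows]
  refine hl _ _ t.isCompactOpenBisection_arrows t'.isCompactOpenBisection_arrows ?_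
  rw [image_src_arrows, image_rng_arrows]
  exact congrArg arrows (ext_of e rfl e)

theorem sum_child (hA : ∀ i j, 0 ≤ A i j) (hrow : ∀ i, ∃ j, A i j ≠ 0) (hpf : PseudoFree A B)
    (l : (Restriction S → ℚ) →ₗ[ℚ] ℚ) (t : Cell S) :
    l (ind t.arrows) = ∑ e : OutEdge A t.β.tgt, l (ind (t.child e).arrows) :=
  (tree S hA hrow hpf).isHarmonic_ind l t

/-- A weight which is the sum of the weights of the children comes from a functional. -/
theorem exists_functional (hA : ∀ i j, 0 ≤ A i j) (hrow : ∀ i, ∃ j, A i j ≠ 0)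
    (hpf : PseudoFree A B) {w : Cell S → ℚ}
    (hw : ∀ t, w t = ∑ e : OutEdge A t.β.tgt, w (t.child e)) :
    ∃ l : (Restriction S → ℚ) →ₗ[ℚ] ℚ, ∀ t : Cell S, l (ind t.arrows) = w t :=
  SetTree.IsHarmonic.exists_functional (tree S hA hrow hpf) hw

end Cell

end Katsura

namespace Katsura

open ArrowGroupoid

variable {N : ℕ} {A B : Matrix (Fin N) (Fin N) ℤ} {S : Set (UnitSpace (KEP A B))}

/-- The vertices which are ranges of finite paths `α` with `Z(α) ⊆ S`. -/
def vertices (S : Set (UnitSpace (KEP A B))) : Set (Fin N) :=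
  {v | ∃ α : FinPath A, α.tgt = v ∧ InSet S α}

noncomputable instance : Fintype (vertices S) := Fintype.ofFinite _

theorem InSet.tgt_mem {α : FinPath A} (h : InSet S α) : α.tgt ∈ vertices S := ⟨α, rfl, h⟩

theorem tgt_mem_vertices {e : Edge A} (h : e.src ∈ vertices S) : e.tgt ∈ vertices S := by
  obtain ⟨α, hα, h⟩ := h
  exact (h.snoc e hα).tgt_mem

/-- A path with range `v` and cylinder in `S`. -/
noncomputable def base (v : vertices S) : FinPath A := v.2.choose

theorem base_tgt (v : vertices S) : (base v).tgt = v := v.2.choose_spec.1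

theorem base_inSet (v : vertices S) : InSet S (base v) := v.2.choose_spec.2

/-- The part of a matrix that belongs to the vertices of `S`, with rational entries. -/
def restrict (S : Set (UnitSpace (KEP A B))) (M : Matrix (Fin N) (Fin N) ℤ) :
    Matrix (vertices S) (vertices S) ℚ :=
  (M.map (Int.cast : ℤ → ℚ)).submatrix Subtype.val Subtype.val

open Classical in
/-- The extension by zero of a function on the vertices of `S`. -/
noncomputable def extend (f : vertices S → ℚ) (w : Fin N) : ℚ :=
  if h : w ∈ vertices S then f ⟨w, h⟩ else 0

theorem extend_of_mem (f : vertices S → ℚ) {w : Fin N} (h : w ∈ vertices S) :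
    extend f w = f ⟨w, h⟩ := dif_pos h

theorem sum_mul_extend (M : Matrix (Fin N) (Fin N) ℤ) (f : vertices S → ℚ) (v : vertices S) :
    ∑ w, (M v w : ℚ) * extend f w = (restrict S M).mulVec f v := by
  classical
  rw [← Finset.sum_subset (Finset.filter_subset (· ∈ vertices S) Finset.univ)]
  · rw [Finset.sum_subtype (p := (· ∈ vertices S)) (Finset.univ.filter (· ∈ vertices S)) (by simp)
      (fun w => (M v w : ℚ) * extend f w)]
    exact Finset.sum_congr rfl fun w _ => by rw [extend_of_mem f w.2]; rfl
  · intro w _ hw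
    rw [extend, dif_neg (by simpa using hw), mul_zero]

theorem sum_outEdge_cast {v v' : Fin N} (h : v = v') (f : ∀ e : Edge A, v = e.src → ℚ) :
    ∑ e : OutEdge A v, f e.1 e.2 = ∑ e : OutEdge A v', f e.1 (h.trans e.2) := by
  subst h
  rfl

namespace Cell

/-- The triple `(β, 0, β)`. -/
def idCell (β : FinPath A) (h : InSet S β) : Cell S := ⟨β, 0, β, rfl, h, h⟩

/-- The triple `(β, m, β)`, where `β` is the chosen path with range `v`. -/
noncomputable def loop (v : vertices S) (m : ℤ) : Cell S :=
  ⟨base v, m, base v, rfl, base_inSet v, base_inSet v⟩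

/-- The triple `(β, 0, α)`, where `α` is the chosen path with range `r(β)`. -/
noncomputable def toBase (β : FinPath A) (h : InSet S β) : Cell S :=
  ⟨β, 0, base ⟨β.tgt, h.tgt_mem⟩, (base_tgt (⟨β.tgt, h.tgt_mem⟩ : vertices S)).symm, h,
    base_inSet _⟩

theorem sum_idCell_snoc (hA : ∀ i j, 0 ≤ A i j) (hrow : ∀ i, ∃ j, A i j ≠ 0)
    (hpf : PseudoFree A B) (l : (Restriction S → ℚ) →ₗ[ℚ] ℚ) (β : FinPath A) (h : InSet S β) :
    l (ind (idCell β h).arrows) =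
      ∑ e : OutEdge A β.tgt, l (ind (idCell (β.snoc e.1 e.2) (h.snoc _ _)).arrows) := by
  rw [sum_child hA hrow hpf l]
  exact Finset.sum_congr rfl fun e _ => congrArg (fun t : Cell S => l (ind t.arrows)) (child_unit β h e)

theorem weight_loop {w : Cell S → ℚ}
    (hw : ∀ (t t' : Cell S) (e : t.β = t'.α), w (t.comp t' e) = w t + w t') (v : vertices S) (m : ℤ) : w (loop v m) = m * w (loop v 1) := by
  let f : ℤ →+ ℚ := AddMonoidHom.mk' (fun m => w (loop v m)) fun m n =>
    hw (loop v m) (loop v n) rfl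
  have h := map_zsmul f m 1
  rw [smul_eq_mul, mul_one, zsmul_eq_mul] at h
  exact h

theorem weight_eq {w : Cell S → ℚ}
    (hw : ∀ (t t' : Cell S) (e : t.β = t'.α), w (t.comp t' e) = w t + w t') (t : Cell S) :
    w t = w (toBase t.α t.hα) + t.m * extend (fun v => w (loop v 1)) t.β.tgt -
      w (toBase t.β t.hβ) := by
  set v : vertices S := ⟨t.β.tgt, t.hβ.tgt_mem⟩ with hv
  have e : (⟨t.α.tgt, t.hα.tgt_mem⟩ : vertices S) = v := Subtype.ext t.tgt_eq
  have e' : base ⟨t.α.tgt, t.hα.tgt_mem⟩ = base v := congrArg base e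
  have h1 := hw t (toBase t.β t.hβ) rfl
  have h2 := hw (toBase t.α t.hα) (loop v t.m) e'
  have h3 : t.comp (toBase t.β t.hβ) rfl = (toBase t.α t.hα).comp (loop v t.m) e' :=
    ext_of rfl ((add_zero t.m).trans (zero_add t.m).symm) rfl
  rw [h3, h2, weight_loop hw] at h1
  rw [extend_of_mem _ t.hβ.tgt_mem]
  linarith

/-- The values of a functional on the triples `(α, 1, α)`. -/
noncomputable def loopMap (S : Set (UnitSpace (KEP A B))) :
    ((Restriction S → ℚ) →ₗ[ℚ] ℚ) →ₗ[ℚ] (vertices S → ℚ) where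
  toFun l v := l (ind (loop v 1).arrows)
  map_add' _ _ := rfl
  map_smul' _ _ := rfl

/-- The sums of the values of a functional on the triples that replace one path of length one
beyond a chosen path by a chosen path. -/
noncomputable def defectMap (S : Set (UnitSpace (KEP A B))) :
    ((Restriction S → ℚ) →ₗ[ℚ] ℚ) →ₗ[ℚ] (vertices S → ℚ) where
  toFun l v := ∑ e : OutEdge A (base v).tgt,
    l (ind (toBase ((base v).snoc e.1 e.2) ((base_inSet v).snoc _ _)).arrows)
  map_add' l l' := by
    funext v
    simp [Finset.sum_add_distrib]
  map_smul' c l := by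
    funext v
    simp [Finset.mul_sum]

/-- The values of a functional on the triples `(α, 0, α)`. -/
noncomputable def unitMap (S : Set (UnitSpace (KEP A B))) :
    ((Restriction S → ℚ) →ₗ[ℚ] ℚ) →ₗ[ℚ] (vertices S → ℚ) where
  toFun l v := l (ind (idCell (base v) (base_inSet v)).arrows)
  map_add' _ _ := rfl
  map_smul' _ _ := rfl

theorem sum_outEdge_tgt (hA : ∀ i j, 0 ≤ A i j) (f : vertices S → ℚ) {v : Fin N}
    (hv : v ∈ vertices S) :
    ∑ e : OutEdge A v, extend f e.1.tgt = (restrict S A).mulVec f ⟨v, hv⟩ := by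
  rw [sum_outEdge hA]
  exact sum_mul_extend A f ⟨v, hv⟩

theorem mem_ker_one_sub {n : Type*} [Fintype n] [DecidableEq n] (M : Matrix n n ℚ) (f : n → ℚ) :
    f ∈ LinearMap.ker (1 - M).mulVecLin ↔ M.mulVec f = f := by
  rw [LinearMap.mem_ker, Matrix.mulVecLin_apply, Matrix.sub_mulVec, Matrix.one_mulVec,
    sub_eq_zero, eq_comm]

/-! ### Invariant functionals -/

theorem idCell_of_mem_invariants {l : (Restriction S → ℚ) →ₗ[ℚ] ℚ}
    (hl : l ∈ invariants (Restriction S)) (β : FinPath A) (h : InSet S β) :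
    l (ind (idCell β h).arrows) = extend (unitMap S l) β.tgt := by
  have h1 := hl _ (toBase β h).isCompactOpenBisection_arrows
  rw [image_src_arrows, image_rng_arrows] at h1
  rw [extend_of_mem _ h.tgt_mem]
  exact h1.symm

theorem unitMap_mem_ker (hA : ∀ i j, 0 ≤ A i j) (hrow : ∀ i, ∃ j, A i j ≠ 0)
    (hpf : PseudoFree A B) {l : (Restriction S → ℚ) →ₗ[ℚ] ℚ}
    (hl : l ∈ invariants (Restriction S)) :
    unitMap S l ∈ LinearMap.ker (1 - restrict S A).mulVecLin := by
  rw [mem_ker_one_sub]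
  funext v
  have h := sum_idCell_snoc hA hrow hpf l (base v) (base_inSet v)
  rw [Finset.sum_congr rfl fun e _ => idCell_of_mem_invariants hl _ _] at h
  have h2 := sum_outEdge_tgt hA (unitMap S l) (base_inSet v).tgt_mem
  have e : (⟨(base v).tgt, (base_inSet v).tgt_mem⟩ : vertices S) = v := Subtype.ext (base_tgt v)
  rw [e] at h2
  exact h2.symm.trans h.symm

theorem invariantDim_restriction (hA : ∀ i j, 0 ≤ A i j) (hrow : ∀ i, ∃ j, A i j ≠ 0)
    (hpf : PseudoFree A B) (hS : IsOpen S) :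
    invariantDim (Restriction S) =
      Module.finrank ℚ (LinearMap.ker (1 - restrict S A).mulVecLin) := by
  let Φ : invariants (Restriction S) →ₗ[ℚ] LinearMap.ker (1 - restrict S A).mulVecLin :=
    ((unitMap S).comp (invariants (Restriction S)).subtype).codRestrict _
      fun l => unitMap_mem_ker hA hrow hpf l.2
  have hker : (nullFunctionals (Restriction S)).submoduleOf (invariants (Restriction S)) =
      LinearMap.ker Φ := by
    ext l
    constructor
    · intro h
      refine LinearMap.mem_ker.2 (Subtype.ext (funext fun v => ?_))
      have h1 := h _ (loop v 0).isCompactOpenBisection_arrows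
      rw [image_src_arrows] at h1
      exact h1
    · intro h
      have h0 : unitMap S l.1 = 0 := congrArg Subtype.val (LinearMap.mem_ker.1 h)
      refine mem_nullFunctionals_of hA hrow hpf hS fun t => ?_
      refine (idCell_of_mem_invariants l.2 t.β t.hβ).trans ?_
      rw [extend_of_mem _ t.hβ.tgt_mem, h0]
      rfl
  have hsurj : Function.Surjective Φ := by
    rintro ⟨f, hf⟩
    have hw : ∀ t : Cell S, extend f t.β.tgt = ∑ e : OutEdge A t.β.tgt, extend f (t.child e).β.tgt := by
      intro t
      refine Eq.trans ?_ (sum_outEdge_tgt hA f t.hβ.tgt_mem).symm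
      rw [(mem_ker_one_sub _ _).1 hf, extend_of_mem _ t.hβ.tgt_mem]
    obtain ⟨l, hl⟩ := exists_functional hA hrow hpf hw
    have hmem : l ∈ invariants (Restriction S) :=
      mem_invariants_of hA hrow hpf hS fun t => by
        rw [hl, hl]
        exact congrArg (extend f) t.tgt_eq.symm
    refine ⟨⟨l, hmem⟩, Subtype.ext (funext fun v => (hl _).trans ?_)⟩
    change extend f (base v).tgt = f v
    rw [base_tgt, extend_of_mem f v.2]
  rw [invariantDim, hker]
  exact (Φ.quotKerEquivOfSurjective hsurj).finrank_eq

/-! ### Cocycles -/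

theorem loopMap_mem_ker (hA : ∀ i j, 0 ≤ A i j) (hrow : ∀ i, ∃ j, A i j ≠ 0)
    (hsupp : ∀ i j, A i j = 0 → B i j = 0) (hpf : PseudoFree A B)
    {l : (Restriction S → ℚ) →ₗ[ℚ] ℚ} (hl : l ∈ cocycles (Restriction S)) :
    loopMap S l ∈ LinearMap.ker (1 - restrict S B).mulVecLin := by
  rw [mem_ker_one_sub]
  funext v
  have h := sum_child hA hrow hpf l (loop v 1)
  have hw := weight_eq (w := fun t => l (ind t.arrows)) (comp_of_mem_cocycles hl)
  rw [Finset.sum_congr rfl fun e _ => hw ((loop v 1).child e), Finset.sum_sub_distrib,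
    Finset.sum_add_distrib] at h
  have h1 := Equiv.sum_comp (outEdgeAct B (base v).tgt 1) fun e : OutEdge A (base v).tgt =>
    l (ind (toBase ((base v).snoc e.1 e.2) ((base_inSet v).snoc _ _)).arrows)
  have h2 := sum_coc_outEdge hA hsupp (base v).tgt 1 (extend (loopMap S l))
  have h3 : ∑ w, (B (base v).tgt w : ℚ) * extend (loopMap S l) w =
      (restrict S B).mulVec (loopMap S l) v := by
    rw [base_tgt]
    exact sum_mul_extend B (loopMap S l) v
  rw [h3, Int.cast_one, one_mul] at h2
  rw [← h2]
  refine Eq.symm (h.trans ?_)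
  exact sub_eq_of_eq_add (add_comm _ _ |>.trans (congrArg _ h1))

/-- The defect of the values of a cocycle on the triples `(β, 0, α)` to be additive. -/
theorem toBase_eq (hA : ∀ i j, 0 ≤ A i j) (hrow : ∀ i, ∃ j, A i j ≠ 0) (hpf : PseudoFree A B)
    {l : (Restriction S → ℚ) →ₗ[ℚ] ℚ} (hl : l ∈ cocycles (Restriction S)) (β : FinPath A)
    (h : InSet S β) :
    l (ind (toBase β h).arrows) = ∑ e : OutEdge A β.tgt,
      l (ind (toBase (β.snoc e.1 e.2) (h.snoc _ _)).arrows) -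
        defectMap S l ⟨β.tgt, h.tgt_mem⟩ := by
  set v : vertices S := ⟨β.tgt, h.tgt_mem⟩ with hv
  have h0 := sum_child hA hrow hpf l (toBase β h)
  have hw := weight_eq (w := fun t => l (ind t.arrows)) (comp_of_mem_cocycles hl)
  have h1 : ∀ e : OutEdge A (base v).tgt, l (ind ((toBase β h).child e).arrows) =
      l (ind (toBase (β.snoc e.1 ((base_tgt v).symm.trans e.2)) (h.snoc _ _)).arrows) -
        l (ind (toBase ((base v).snoc e.1 e.2) ((base_inSet v).snoc _ _)).arrows) := by
    intro e
    have e1 : (toBase β h).child e = ⟨β.snoc e.1 ((base_tgt v).symm.trans e.2), 0,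
        (base v).snoc e.1 e.2, rfl, h.snoc _ _, (base_inSet v).snoc _ _⟩ := by
      refine ext_of ?_ (act_coc_zero B e.1).2 rfl
      exact FinPath.ext_of rfl (congrArg (fun f => β.edges ++ [f]) (act_coc_zero B e.1).1)
    rw [e1]
    refine (hw _).trans ?_
    simp
  refine h0.trans ((Finset.sum_congr rfl fun e _ => h1 e).trans ?_)
  refine (Finset.sum_sub_distrib _ _).trans (congrArg (· - _) ?_)
  exact (sum_outEdge_cast (base_tgt v).symm fun e he =>
    l (ind (toBase (β.snoc e he) (h.snoc _ _)).arrows)).symm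

theorem mem_coboundaries_of_eq_zero (hA : ∀ i j, 0 ≤ A i j) (hrow : ∀ i, ∃ j, A i j ≠ 0)
    (hpf : PseudoFree A B) (hS : IsOpen S) {l : (Restriction S → ℚ) →ₗ[ℚ] ℚ}
    (hl : l ∈ cocycles (Restriction S)) (h0 : loopMap S l = 0)
    (h1 : defectMap S l ∈ LinearMap.range (1 - restrict S A).mulVecLin) :
    l ∈ coboundaries (Restriction S) := by
  obtain ⟨f, hf⟩ := h1
  rw [Matrix.mulVecLin_apply, Matrix.sub_mulVec, Matrix.one_mulVec] at hf
  have hk : ∀ t : Cell S, -extend f t.β.tgt - l (ind (toBase t.β t.hβ).arrows) =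
      ∑ e : OutEdge A t.β.tgt, (-extend f (t.child e).β.tgt -
        l (ind (toBase (t.child e).β (t.child e).hβ).arrows)) := by
    intro t
    have h2 := toBase_eq hA hrow hpf hl t.β t.hβ
    have h3 := sum_outEdge_tgt hA f t.hβ.tgt_mem
    rw [Finset.sum_sub_distrib, Finset.sum_neg_distrib]
    have h4 := congrFun hf ⟨t.β.tgt, t.hβ.tgt_mem⟩
    rw [Pi.sub_apply, ← h3] at h4
    rw [h2, extend_of_mem f t.hβ.tgt_mem, ← h4]
    change _ = -∑ e : OutEdge A t.β.tgt, extend f e.1.tgt - ∑ e : OutEdge A t.β.tgt,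
      l (ind (toBase (t.β.snoc e.1 e.2) (t.hβ.snoc _ _)).arrows)
    ring
  obtain ⟨k, hk⟩ := exists_functional hA hrow hpf hk
  refine mem_coboundaries_of hA hrow hpf hS (k := k) fun t => ?_
  have hw := weight_eq (w := fun t => l (ind t.arrows)) (comp_of_mem_cocycles hl) t
  have h5 : extend (fun v => l (ind (loop v 1).arrows)) t.β.tgt = 0 := by
    rw [extend_of_mem _ t.hβ.tgt_mem]
    exact congrFun h0 _
  simp only [h5, mul_zero, add_zero] at hw
  rw [hk, hk, hw]
  change _ = (-extend f t.β.tgt - l (ind (toBase t.β t.hβ).arrows)) -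
    (-extend f t.α.tgt - l (ind (toBase t.α t.hα).arrows))
  rw [t.tgt_eq]
  ring

theorem eq_of_mem_coboundaries (hA : ∀ i j, 0 ≤ A i j) (hrow : ∀ i, ∃ j, A i j ≠ 0)
    (hpf : PseudoFree A B) {l : (Restriction S → ℚ) →ₗ[ℚ] ℚ}
    (hl : l ∈ coboundaries (Restriction S)) : loopMap S l = 0 ∧
      defectMap S l ∈ LinearMap.range (1 - restrict S A).mulVecLin := by
  obtain ⟨k, hk⟩ := hl
  have hk' : ∀ t : Cell S, l (ind t.arrows) =
      k (ind t.srcCell.arrows) - k (ind t.rngCell.arrows) := fun t => by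
    rw [hk _ t.isCompactOpenBisection_arrows, image_src_arrows, image_rng_arrows]
  refine ⟨funext fun v => (hk' _).trans (sub_self _), -unitMap S k, ?_⟩
  rw [map_neg, Matrix.mulVecLin_apply, Matrix.sub_mulVec, Matrix.one_mulVec, neg_sub]
  funext v
  have h1 := sum_idCell_snoc hA hrow hpf k (base v) (base_inSet v)
  have h2 := sum_outEdge_tgt hA (unitMap S k) (base_inSet v).tgt_mem
  have e : (⟨(base v).tgt, (base_inSet v).tgt_mem⟩ : vertices S) = v := Subtype.ext (base_tgt v)
  rw [e] at h2
  rw [Pi.sub_apply, ← h2]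
  refine (congrArg _ h1).trans ?_
  rw [← Finset.sum_sub_distrib]
  refine Finset.sum_congr rfl fun f _ => ?_
  refine Eq.trans ?_ (hk' _).symm
  exact congrArg (· - _) (extend_of_mem (unitMap S k) ((base_inSet v).snoc f.1 f.2).tgt_mem)

open Classical in
/-- A function on finite paths whose sum over all prolongations of a path by an edge exceeds its
value by a given amount that depends only on the range. -/
noncomputable def pathWeight (γ : Fin N → Edge A) (f : Fin N → ℚ) (β : FinPath A) : ℚ :=
  β.edges.foldl (fun x e => if e = γ e.src then x + f e.src else 0) 0

theorem sum_pathWeight_snoc {γ : Fin N → Edge A} (hγ : ∀ v, (γ v).src = v) (f : Fin N → ℚ)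
    (β : FinPath A) {v : Fin N} (h : β.tgt = v) :
    ∑ e : OutEdge A v, pathWeight γ f (β.snoc e.1 (h.trans e.2)) = pathWeight γ f β + f v := by
  rw [Finset.sum_eq_single (⟨γ v, (hγ v).symm⟩ : OutEdge A v)]
  · simp [pathWeight, FinPath.snoc, hγ]
  · rintro ⟨e, rfl⟩ - he
    have : e ≠ γ e.src := fun h' => he (Subtype.ext h')
    simp [pathWeight, FinPath.snoc, this]
  · simp

theorem exists_cocycle (hA : ∀ i j, 0 ≤ A i j) (hrow : ∀ i, ∃ j, A i j ≠ 0)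
    (hsupp : ∀ i j, A i j = 0 → B i j = 0) (hpf : PseudoFree A B) (hS : IsOpen S)
    {b : vertices S → ℚ} (hb : b ∈ LinearMap.ker (1 - restrict S B).mulVecLin)
    (a : vertices S → ℚ) :
    ∃ l ∈ cocycles (Restriction S), loopMap S l = b ∧
      defectMap S l - a ∈ LinearMap.range (1 - restrict S A).mulVecLin := by
  have hγ : ∀ i, ∃ e : Edge A, e.src = i := fun i => by
    obtain ⟨y, hy⟩ := exists_infPath hA hrow i
    exact ⟨y.1 0, hy.symm⟩
  choose γ hγ using hγ
  set d := pathWeight γ (extend a) with hd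
  have hw : ∀ t : Cell S, d t.α + t.m * extend b t.β.tgt - d t.β =
      ∑ e : OutEdge A t.β.tgt, (d (t.child e).α + (t.child e).m * extend b (t.child e).β.tgt -
        d (t.child e).β) := by
    intro t
    have h1 := sum_pathWeight_snoc hγ (extend a) t.α t.tgt_eq
    have h2 := sum_pathWeight_snoc hγ (extend a) t.β rfl
    have h3 := sum_coc_outEdge hA hsupp t.β.tgt t.m (extend b)
    rw [sum_mul_extend B b ⟨t.β.tgt, t.hβ.tgt_mem⟩, (mem_ker_one_sub _ _).1 hb,
      ← extend_of_mem b t.hβ.tgt_mem] at h3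
    rw [← Equiv.sum_comp (outEdgeAct B t.β.tgt t.m)] at h1
    rw [Finset.sum_sub_distrib, Finset.sum_add_distrib]
    have h4 : d t.α + t.m * extend b t.β.tgt - d t.β = (d t.α + extend a t.β.tgt) +
      t.m * extend b t.β.tgt - (d t.β + extend a t.β.tgt) := by ring
    rw [h4, hd, ← h1, ← h2, ← h3]
    rfl
  obtain ⟨l, hl⟩ := exists_functional hA hrow hpf hw
  refine ⟨l, mem_cocycles_of hA hrow hpf hS fun t t' e => ?_, funext fun v => ?_,
    fun v => d (base v), ?_⟩
  · rw [hl, hl, hl]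
    change d t.α + ((t.m + t'.m : ℤ) : ℚ) * extend b t'.β.tgt - d t'.β = _
    have e1 : t.β.tgt = t'.β.tgt := by rw [e, t'.tgt_eq]
    rw [e1, e]
    push_cast
    ring
  · refine (hl _).trans ?_
    change d (base v) + ((1 : ℤ) : ℚ) * extend b (base v).tgt - d (base v) = b v
    rw [base_tgt, extend_of_mem b v.2]
    push_cast
    ring
  · rw [Matrix.mulVecLin_apply, Matrix.sub_mulVec, Matrix.one_mulVec]
    funext v
    have h1 : ∀ e : OutEdge A (base v).tgt,
        l (ind (toBase ((base v).snoc e.1 e.2) ((base_inSet v).snoc _ _)).arrows) =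
          d ((base v).snoc e.1 e.2) - extend (fun v : vertices S => d (base v)) e.1.tgt := by
      intro e
      have h0 := extend_of_mem (fun v : vertices S => d (base v))
        ((base_inSet v).snoc e.1 e.2).tgt_mem
      refine (hl _).trans (Eq.trans ?_ (congrArg (_ - ·) h0.symm))
      change _ + ((0 : ℤ) : ℚ) * _ - _ = _
      rw [Int.cast_zero, zero_mul, add_zero]
      rfl
    have h2 : defectMap S l v = ∑ e : OutEdge A (base v).tgt,
        (d ((base v).snoc e.1 e.2) - extend (fun v : vertices S => d (base v)) e.1.tgt) :=
      Finset.sum_congr rfl fun e _ => h1 e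
    have h3 := sum_outEdge_tgt hA (fun v : vertices S => d (base v)) (base_inSet v).tgt_mem
    have e : (⟨(base v).tgt, (base_inSet v).tgt_mem⟩ : vertices S) = v := Subtype.ext (base_tgt v)
    rw [e] at h3
    rw [Finset.sum_sub_distrib, h3, hd, sum_pathWeight_snoc hγ (extend a) (base v) rfl, base_tgt,
      extend_of_mem a v.2] at h2
    rw [Pi.sub_apply, Pi.sub_apply, h2]
    ring

theorem cocycleDim_restriction (hA : ∀ i j, 0 ≤ A i j) (hrow : ∀ i, ∃ j, A i j ≠ 0)
    (hsupp : ∀ i j, A i j = 0 → B i j = 0) (hpf : PseudoFree A B) (hS : IsOpen S) :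
    cocycleDim (Restriction S) =
      Module.finrank ℚ (LinearMap.ker (1 - restrict S B).mulVecLin) +
        Module.finrank ℚ (LinearMap.ker (1 - restrict S A).mulVecLin) := by
  let Φ : cocycles (Restriction S) →ₗ[ℚ] LinearMap.ker (1 - restrict S B).mulVecLin ×
      ((vertices S → ℚ) ⧸ LinearMap.range (1 - restrict S A).mulVecLin) :=
    (((loopMap S).comp (cocycles (Restriction S)).subtype).codRestrict _
      fun l => loopMap_mem_ker hA hrow hsupp hpf l.2).prod
    (((LinearMap.range (1 - restrict S A).mulVecLin).mkQ.comp (defectMap S)).comp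
      (cocycles (Restriction S)).subtype)
  have hker : (coboundaries (Restriction S)).submoduleOf (cocycles (Restriction S)) =
      LinearMap.ker Φ := by
    ext l
    have h1 : l ∈ LinearMap.ker Φ ↔ loopMap S l.1 = 0 ∧
        defectMap S l.1 ∈ LinearMap.range (1 - restrict S A).mulVecLin := by
      rw [LinearMap.mem_ker, Prod.ext_iff, Subtype.ext_iff,
        ← Submodule.Quotient.mk_eq_zero (LinearMap.range (1 - restrict S A).mulVecLin)]
      rfl
    rw [h1]
    exact ⟨eq_of_mem_coboundaries hA hrow hpf,
      fun h => mem_coboundaries_of_eq_zero hA hrow hpf hS l.2 h.1 h.2⟩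
  have hsurj : Function.Surjective Φ := by
    rintro ⟨⟨b, hb⟩, a⟩
    obtain ⟨a, rfl⟩ := Submodule.Quotient.mk_surjective _ a
    obtain ⟨l, hl, h1, h2⟩ := exists_cocycle hA hrow hsupp hpf hS hb a
    exact ⟨⟨l, hl⟩, Prod.ext (Subtype.ext h1) ((Submodule.Quotient.eq _).2 h2)⟩
  rw [cocycleDim, hker, (Φ.quotKerEquivOfSurjective hsurj).finrank_eq, Module.finrank_prod,
    finrank_quotient_range]

/-! ### Full open sets of units -/

theorem exists_src_mem_vertices (hS : IsOpen S) (hfull : IsFull S) (x : InfPath A) :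
    ∃ n, (x.1 n).src ∈ vertices S := by
  obtain ⟨g, h1, h2⟩ := hfull (unitPt x)
  obtain ⟨q, rfl⟩ := Quot.exists_rep g
  have hx : q.pt = x := KEP.unit_inj (congrArg Subtype.val h1)
  obtain ⟨n, hn⟩ := exists_inSet hS (x := q.im B) h2
  have hl := KEP.length_iterate (B := B) n q
  set p := (Quad.step B)^[n] q with hp
  have h3 : InSet S p.α := by
    refine hn _ (by omega) ?_
    rw [← Quad.im_iterate n q]
    exact p.im_mem_cylinder
  refine ⟨p.β.edges.length + 0, ?_⟩
  rw [← hx, ← Quad.pt_iterate (B := B) n q]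
  change (prepend p.β.edges p.y.1 _).src ∈ _
  rw [prepend_length_add]
  change p.y.start ∈ _
  rw [← p.hα]
  exact h3.tgt_mem

theorem exists_forall_src_mem_vertices (hS : IsOpen S) (hfull : IsFull S) :
    ∃ n, ∀ x : InfPath A, (x.1 n).src ∈ vertices S := by
  have hmono : Monotone fun n => {x : InfPath A | (x.1 n).src ∈ vertices S} :=
    monotone_nat_of_le_succ fun n x hx => by
      change (x.1 (n + 1)).src ∈ vertices S
      rw [← x.2 n]
      exact tgt_mem_vertices hx
  obtain ⟨n, hn⟩ := isCompact_univ.elim_directed_cover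
    (fun n => {x : InfPath A | (x.1 n).src ∈ vertices S})
    (fun n => InfPath.isOpen_iff.2 fun x hx => ⟨n + 1, fun z hz => by
      change (z.1 n).src ∈ vertices S
      rw [hz n (Nat.lt_succ_self n)]
      exact hx⟩)
    (fun x _ => Set.mem_iUnion.2 (exists_src_mem_vertices hS hfull x)) hmono.directed_le
  exact ⟨n, fun x => hn (Set.mem_univ x)⟩

theorem exists_infPath_of_pow_ne_zero (hA : ∀ i j, 0 ≤ A i j) (hrow : ∀ i, ∃ j, A i j ≠ 0)
    {M : Matrix (Fin N) (Fin N) ℚ} (hM : ∀ i j, A i j = 0 → M i j = 0) (n : ℕ) {v w : Fin N}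
    (h : (M ^ n) v w ≠ 0) : ∃ x : InfPath A, x.start = v ∧ (x.1 n).src = w := by
  induction n generalizing v with
  | zero =>
    obtain ⟨y, hy⟩ := exists_infPath hA hrow v
    refine ⟨y, hy.symm, hy.symm.trans ?_⟩
    by_contra hne
    exact h (by rw [pow_zero, Matrix.one_apply_ne hne])
  | succ n ih =>
    rw [pow_succ', Matrix.mul_apply] at h
    obtain ⟨u, -, hu⟩ := Finset.exists_ne_zero_of_sum_ne_zero h
    obtain ⟨x, rfl, hx⟩ := ih (right_ne_zero_of_mul hu)
    have hne : A v x.start ≠ 0 := fun h0 => left_ne_zero_of_mul hu (hM _ _ h0)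
    exact ⟨x.cons ⟨v, x.start, 0, le_rfl, lt_of_le_of_ne (hA _ _) hne.symm⟩ rfl, rfl, hx⟩

theorem finrank_ker_restrict (hA : ∀ i j, 0 ≤ A i j) (hrow : ∀ i, ∃ j, A i j ≠ 0)
    (hS : IsOpen S) (hfull : IsFull S) (M : Matrix (Fin N) (Fin N) ℤ)
    (hM : ∀ i j, A i j = 0 → M i j = 0) :
    Module.finrank ℚ (LinearMap.ker (1 - restrict S M).mulVecLin) =
      Module.finrank ℚ (LinearMap.ker ((1 - M).map (Int.cast : ℤ → ℚ)).mulVecLin) := by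
  obtain ⟨n, hn⟩ := exists_forall_src_mem_vertices hS hfull
  have hM' : ∀ i j, A i j = 0 → M.map (Int.cast : ℤ → ℚ) i j = 0 := fun i j h => by
    simp [hM i j h]
  have e : (1 - M).map (Int.cast : ℤ → ℚ) = 1 - M.map (Int.cast : ℤ → ℚ) := by
    rw [Matrix.map_sub _ Int.cast_sub, Matrix.map_one _ Int.cast_zero Int.cast_one]
  rw [e, finrank_ker_one_sub_submatrix (M.map (Int.cast : ℤ → ℚ)) (vertices S) ?_ n ?_]
  · rfl
  · intro i hi j hij
    have hne : A i j ≠ 0 := fun h0 => hij (hM' _ _ h0)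
    exact tgt_mem_vertices (e := ⟨i, j, 0, le_rfl, lt_of_le_of_ne (hA _ _) hne.symm⟩) hi
  · intro i j hij
    obtain ⟨x, -, rfl⟩ := exists_infPath_of_pow_ne_zero hA hrow hM' n hij
    exact hn x

end Cell

end Katsura

theorem mainTheorem7 {N N' : ℕ}
    (A B : Matrix (Fin N) (Fin N) ℤ) (A' B' : Matrix (Fin N') (Fin N') ℤ)
    (hA : ∀ i j, 0 ≤ A i j) (hA' : ∀ i j, 0 ≤ A' i j)
    (hrow : ∀ i, ∃ j, A i j ≠ 0) (hrow' : ∀ i, ∃ j, A' i j ≠ 0)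
    (hsupp : ∀ i j, A i j = 0 → B i j = 0) (hsupp' : ∀ i j, A' i j = 0 → B' i j = 0)
    (hpf : Katsura.PseudoFree A B) (hpf' : Katsura.PseudoFree A' B')
    (hK : ArrowGroupoid.KakutaniEquivalent (Katsura.KEP A B) (Katsura.KEP A' B')) :
    Nonempty (LinearMap.ker (1 - A).mulVecLin ≃+ LinearMap.ker (1 - A').mulVecLin) ∧
      Nonempty (LinearMap.ker (1 - B).mulVecLin ≃+ LinearMap.ker (1 - B').mulVecLin) := by
  obtain ⟨S, T, hS, hSf, hT, hTf, ⟨e⟩⟩ := hK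
  have h0 := e.invariantDim_eq
  have h1 := e.cocycleDim_eq
  rw [Katsura.Cell.invariantDim_restriction hA hrow hpf hS.isOpen,
    Katsura.Cell.invariantDim_restriction hA' hrow' hpf' hT.isOpen] at h0
  rw [Katsura.Cell.cocycleDim_restriction hA hrow hsupp hpf hS.isOpen,
    Katsura.Cell.cocycleDim_restriction hA' hrow' hsupp' hpf' hT.isOpen, h0,
    Nat.add_right_cancel_iff] at h1
  rw [Katsura.Cell.finrank_ker_restrict hA hrow hS.isOpen hSf A fun _ _ h => h,
    Katsura.Cell.finrank_ker_restrict hA' hrow' hT.isOpen hTf A' fun _ _ h => h] at h0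
  rw [Katsura.Cell.finrank_ker_restrict hA hrow hS.isOpen hSf B hsupp,
    Katsura.Cell.finrank_ker_restrict hA' hrow' hT.isOpen hTf B' hsupp'] at h1
  exact ⟨nonempty_ker_addEquiv h0, nonempty_ker_addEquiv h1⟩
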